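/- Let $n\ge 1$ and let $\mathfrak S_m$ be the symmetric group on $\{1,\dots,m\}$, with products read as compositions of maps; let $s_i\in\mathfrak S_{n+1}$ be the transposition of $i$ and $i+1$, and $s(n,1)=s_ns_{n-1}\cdots s_1$. The Bruhat order is: $v\le w$ if a reduced decomposition of $v$ is a subword of some reduced decomposition of $w$. For $v\le w$ in $\mathfrak S_{n+1}$, the Bruhat interval polytope is $$Q_{v,w}=\operatorname{Conv}\{(z(1),\dots,z(n+1))\in\mathbb R^{n+1}\mid v\le z\le w\}.$$ For $u\in\mathfrak S_n$ let $t(u)\in\mathfrak S_{n+1}$ be given by $t(u)(i)=u(i)$ for $i\le n$ and $t(u)(n+1)=n+1$, and let $w_0\in\mathfrak S_n$ be the longest element, $w_0(i)=n+1-i$. Let $N=\mathbb Z^{n+1}/\mathbb Z(1,\dots,1)$, which is dual, through the dot product, to the lattice of integer vectors with coordinate sum $0$, and let $\varpi_i\in N$ be the class of $e_1+\dots+e_i$ for $0\le i\le n+1$ (so $\varpi_0=\varpi_{n+1}=0$). The normal fan of a polytope $P\subset\mathbb R^{n+1}$ that lies in a hyperplane of constant coordinate sum is the set of the cones $\{y\in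 N\otimes\mathbb R\mid \langle y,p-f\rangle\ge 0 \text{ for all } p\in P,\ f\in F\}$, where $F$ runs over the nonempty faces of $P$. A triangulation $T$ of the convex $(n+2)$-gon with vertices $0,1,\dots,n+1$ in counterclockwise order is identified with the set of the edges of its $n$ triangles. Starting with the edge $e=\{0,n+1\}$, take the triangle $a<c<b$ of $T$ with the edge $e=\{a,b\}$ as its longest side (so $c$ lies between $a$ and $b$), call $\{a,c\}$ a left edge and $\{c,b\}$ a right edge, and repeat this with $\{a,c\}$ and with $\{c,b\}$ in place of $e$ until only sides of the polygon are left. For each $1\le k\le n$ there is exactly one left edge $\{k_L,k\}$ with $k_L<k$ and exactly one right edge $\{k,k_R\}$ with $k<k_R$. Put $\mathbf v_k=\varpi_k-\varpi_{k_R}$ and $\mathbf w_k=\varpi_{k_L}-\varpi_k$. The fan $\Sigma_T$ in $N\otimes\mathbb R$ consists of the cones $\operatorname{Cone}(Q)$, where $Q$ runs over the subsets of $\{\mathbf v_k,\mathbf w_k\mid 1\le k\le n\}$ with $\{\mathbf v_i,\mathbf w_i\}\not\subset Q$ for all $i$. The binary tree of a finite sequence of distinct numbers is empty for the empty sequence;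 otherwise its root stands for the smallest entry, and its left and right subtrees are the binary trees of the entries before and after that entry. For $u\in\mathfrak S_n$ let $\psi(u)$ be the triangulation of the $(n+2)$-gon that corresponds to the binary tree of $u(1),\dots,u(n)$: the root corresponds to the triangle $0<c<n+1$ for which the polygon with vertices $0,\dots,c$ is triangulated according to the left subtree (with $c-1$ vertices), and the polygon with vertices $c,\dots,n+1$ according to the right subtree, recursively. Two fans with respect to lattices $L$ and $L'$ are isomorphic if the linear extension of some isomorphism of lattices $L\to L'$ maps the cones of the one bijectively to the cones of the other. **Theorem.** For every $u\in\mathfrak S_n$, the normal fan of the Bruhat interval polytope $Q_{t(u),\,t(u)s(n,1)}$ is isomorphic, with respect to the lattice $N$, to the fan $\Sigma_{\psi(w_0uw_0)}$. -/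

import Mathlib

open scoped Pointwise

namespace CatalanFan

/-! ### Symmetric groups and the Bruhat order

The symmetric group on `m` letters is `Equiv.Perm (Fin m)`: the letter `i` of the usual
`1`-based notation is the element `i - 1` of `Fin m`. Products are compositions of maps. -/

/-- The simple transposition `s_i` of the symmetric group on `n + 1` letters. -/
def simpleTransposition {n : ℕ} (i : Fin n) : Equiv.Perm (Fin (n + 1)) :=
  Equiv.swap i.castSucc i.succ

/-- The product `s_{i_1} ⋯ s_{i_l}` of a word `i_1, …, i_l`. -/
def wordProd {n : ℕ} (ω : List (Fin n)) : Equiv.Perm (Fin (n + 1)) :=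
  (ω.map simpleTransposition).prod

/-- `ω` is a reduced decomposition of `w`: its product is `w`, and no word with product `w`
is shorter. -/
def IsReducedWord {n : ℕ} (ω : List (Fin n)) (w : Equiv.Perm (Fin (n + 1))) : Prop :=
  wordProd ω = w ∧ ∀ ω' : List (Fin n), wordProd ω' = w → ω.length ≤ ω'.length

/-- The Bruhat order: `v ≤ w` if a reduced decomposition of `v` is a (not necessarily
contiguous) subword of some reduced decomposition of `w`. -/
def BruhatLE {n : ℕ} (v w : Equiv.Perm (Fin (n + 1))) : Prop :=
  ∃ ω' ω : List (Fin n), IsReducedWord ω' v ∧ IsReducedWord ω w ∧ ω'.Sublist ω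

/-- The permutation `u(1) u(2) ⋯ u(n) (n+1)` obtained from `u` by putting the new largest
letter at the tail of the one-line notation. -/
def addTail {n : ℕ} (u : Equiv.Perm (Fin n)) : Equiv.Perm (Fin (n + 1)) :=
  (finSuccEquivLast.trans u.optionCongr).trans finSuccEquivLast.symm

theorem addTail_castSucc {n : ℕ} (u : Equiv.Perm (Fin n)) (i : Fin n) :
    addTail u i.castSucc = (u i).castSucc := by
  simp [addTail]

theorem addTail_last {n : ℕ} (u : Equiv.Perm (Fin n)) :
    addTail u (Fin.last n) = Fin.last n := by
  simp [addTail]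

/-- `s(n,1) = s_n s_{n-1} ⋯ s_1`. -/
def sDown (n : ℕ) : Equiv.Perm (Fin (n + 1)) :=
  wordProd (List.finRange n).reverse

/-! ### Bruhat interval polytopes -/

/-- The point `(z(1), …, z(n+1))` of `ℝ^{n+1}`. -/
def permPoint {n : ℕ} (z : Equiv.Perm (Fin (n + 1))) : Fin (n + 1) → ℝ :=
  fun i => ((z i : ℕ) : ℝ) + 1

/-- The Bruhat interval polytope `Q_{v,w}`. -/
def bruhatIntervalPolytope {n : ℕ} (v w : Equiv.Perm (Fin (n + 1))) :
    Set (Fin (n + 1) → ℝ) :=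
  convexHull ℝ (permPoint '' {z | BruhatLE v z ∧ BruhatLE z w})

/-! ### The lattice `N = ℤ^{n+1} / ℤ(1,…,1)` -/

/-- The line `ℝ(1,…,1)` in `ℝ^{n+1}`. -/
def diagonalLine (n : ℕ) : Submodule ℝ (Fin (n + 1) → ℝ) :=
  Submodule.span ℝ {fun _ => 1}

/-- The real vector space `N ⊗ ℝ = ℝ^{n+1} / ℝ(1,…,1)`, the dual of the space of vectors in
`ℝ^{n+1}` with coordinate sum `0`. -/
abbrev NReal (n : ℕ) : Type := (Fin (n + 1) → ℝ) ⧸ diagonalLine n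

/-- The lattice `N = ℤ^{n+1} / ℤ(1,…,1)` inside `N ⊗ ℝ`: the classes of the integer vectors. -/
def latticeN (n : ℕ) : AddSubgroup (NReal n) :=
  ((Int.castAddHom ℝ).compLeft (Fin (n + 1))).range.map (diagonalLine n).mkQ.toAddMonoidHom

/-- `ϖ_i ∈ N`, the class of `e_1 + ⋯ + e_i`. -/
def varpi (n i : ℕ) : NReal n :=
  (diagonalLine n).mkQ fun j => if (j : ℕ) < i then 1 else 0

/-! ### Normal fans and isomorphisms of fans -/

/-- The (inner) normal cone of a face `F` of a polytope `P ⊆ ℝ^{n+1}` that lies in a hyperplane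
of constant coordinate sum, as a cone in `N ⊗ ℝ`: the classes of those `y` with
`⟨y, p⟩ ≥ ⟨y, f⟩` for all `p ∈ P`, `f ∈ F`. -/
noncomputable def normalCone {n : ℕ} (P F : Set (Fin (n + 1) → ℝ)) : PointedCone ℝ (NReal n) :=
  PointedCone.map (diagonalLine n).mkQ (PointedCone.dual (dotProductBilin ℝ ℝ) (P - F))

/-- The normal fan of a polytope: the set of the normal cones of its nonempty faces. -/
noncomputable def normalFan {n : ℕ} (P : Set (Fin (n + 1) → ℝ)) :
    Set (PointedCone ℝ (NReal n)) :=
  {σ | ∃ F : Set (Fin (n + 1) → ℝ), F.Nonempty ∧ IsExposed ℝ P F ∧ σ = normalCone P F}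

/-- Two fans `Σ` and `Σ'`, in the real vector spaces `V`, `V'` and with respect to the lattices
`L ⊆ V`, `L' ⊆ V'`, are isomorphic: the linear extension `Φ : V → V'` of some isomorphism of
lattices `L → L'` maps the cones of `Σ` bijectively to the cones of `Σ'`. -/
def FanIsomorphic {V V' : Type} [AddCommGroup V] [Module ℝ V] [AddCommGroup V'] [Module ℝ V']
    (L : AddSubgroup V) (S : Set (PointedCone ℝ V))
    (L' : AddSubgroup V') (S' : Set (PointedCone ℝ V')) : Prop :=
  ∃ Φ : V ≃ₗ[ℝ] V', L.map (Φ : V →ₗ[ℝ] V').toAddMonoidHom = L' ∧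
    Set.BijOn (PointedCone.map (Φ : V →ₗ[ℝ] V')) S S'

/-! ### Triangulations of polygons -/

/-- A triangulation of the convex `(n+2)`-gon with vertices `0, 1, …, n+1` in counterclockwise
order, as the set of the edges of its triangles. An edge with end points `a < b` is the pair
`(a, b)`. The set contains all sides of the polygon, no two of its members cross, and it has
`(n + 2) + (n - 1) = 2 n + 1` elements (for `n = 0` the polygon degenerates to one edge). -/
structure Triangulation (n : ℕ) where
  edges : Finset (ℕ × ℕ)
  isEdge : ∀ e ∈ edges, e.1 < e.2 ∧ e.2 ≤ n + 1
  side_mem : ∀ i ≤ n, (i, i + 1) ∈ edges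
  distinguished_mem : (0, n + 1) ∈ edges
  noncrossing : ∀ e ∈ edges, ∀ f ∈ edges, ¬ (e.1 < f.1 ∧ f.1 < e.2 ∧ e.2 < f.2)
  card_eq : edges.card = 2 * n + 1

namespace Triangulation

variable {n : ℕ} (T : Triangulation n)

/-- `a < c < b` are the vertices of a triangle of `T`. -/
def IsTriangle (a c b : ℕ) : Prop :=
  a < c ∧ c < b ∧ (a, c) ∈ T.edges ∧ (c, b) ∈ T.edges ∧ (a, b) ∈ T.edges

/-- The edges met by the recursive process which starts at the distinguished edge
`e = {0, n+1}`. At an edge `e = {a, b}` one takes the triangle with vertices `a < c < b`; its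
other edges, in counterclockwise order `f_L(e), f_R(e), e`, are `f_L(e) = {a, c}` and
`f_R(e) = {c, b}`; then the process continues at `f_L(e)` and `f_R(e)`. -/
inductive Reached : ℕ → ℕ → Prop
  | root : Reached 0 (n + 1)
  | left {a c b : ℕ} : Reached a b → T.IsTriangle a c b → Reached a c
  | right {a c b : ℕ} : Reached a b → T.IsTriangle a c b → Reached c b

/-- `{a, c}` with `a < c` is an edge of the left tree: it is `f_L(e)` for some `e`. -/
def IsLeftEdge (a c : ℕ) : Prop := ∃ b, T.Reached a b ∧ T.IsTriangle a c b

/-- `{c, b}` with `c < b` is an edge of the right tree: it is `f_R(e)` for some `e`. -/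
def IsRightEdge (c b : ℕ) : Prop := ∃ a, T.Reached a b ∧ T.IsTriangle a c b

/-- `k_L`: for `1 ≤ k ≤ n`, the only `a` such that `{a, k}`, `a < k`, is in the left tree. -/
noncomputable def leftNbr (k : ℕ) : ℕ := sInf {a | T.IsLeftEdge a k}

/-- `k_R`: for `1 ≤ k ≤ n`, the only `b` such that `{k, b}`, `k < b`, is in the right tree. -/
noncomputable def rightNbr (k : ℕ) : ℕ := sInf {b | T.IsRightEdge k b}

/-- The vector `v_k = ϖ_k - ϖ_{k_R}`. -/
noncomputable def vVec (k : ℕ) : NReal n := varpi n k - varpi n (T.rightNbr k)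

/-- The vector `w_k = ϖ_{k_L} - ϖ_k`. -/
noncomputable def wVec (k : ℕ) : NReal n := varpi n (T.leftNbr k) - varpi n k

/-- The fan `Σ_T`: its cones are spanned by the subsets `Q` of `{v_k, w_k | 1 ≤ k ≤ n}` which
contain `{v_i, w_i}` for no `i`. -/
noncomputable def fan : Set (PointedCone ℝ (NReal n)) :=
  {σ | ∃ Q : Set (NReal n),
    (∀ y ∈ Q, ∃ k ∈ Finset.Icc 1 n, y = T.vVec k ∨ y = T.wVec k) ∧
    (∀ i ∈ Finset.Icc 1 n, ¬ (T.vVec i ∈ Q ∧ T.wVec i ∈ Q)) ∧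
    σ = PointedCone.hull ℝ Q}

/-- The binary tree of the part of `T` that is cut off by the edge `{a, b}`, `a < b` (the
polygon with vertices `a, a + 1, …, b`). It is empty if `b = a + 1`. Otherwise the root is the
triangle `a < c < b` of `T`, and the left and right subtrees belong to `{a, c}` and `{c, b}`. -/
inductive HasTree : ℕ → ℕ → BinaryTree Unit → Prop
  | nil (a : ℕ) : HasTree a (a + 1) .nil
  | node {a c b : ℕ} {l r : BinaryTree Unit} : T.IsTriangle a c b →
      HasTree a c l → HasTree c b r → HasTree a b (.node () l r)

end Triangulation

/-- The edges of the triangulation, with binary tree `t`, of the polygon with vertices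
`a, a + 1, …, a + m + 1`, where `m` is the number of vertices of `t`. The triangle that
corresponds to the root has the vertices `a < c < a + m + 1`, where `c - a - 1` is the number of
vertices of the left subtree. -/
def treeEdges : BinaryTree Unit → ℕ → Finset (ℕ × ℕ)
  | .nil, a => {(a, a + 1)}
  | .node _ l r, a =>
      insert (a, a + (l.numNodes + r.numNodes + 1) + 1)
        (treeEdges l a ∪ treeEdges r (a + l.numNodes + 1))

theorem treeEdges_bounds (t : BinaryTree Unit) (a : ℕ) :
    ∀ e ∈ treeEdges t a, a ≤ e.1 ∧ e.1 < e.2 ∧ e.2 ≤ a + t.numNodes + 1 := by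
  induction t generalizing a with
  | nil => simp [treeEdges]
  | node x l r hl hr =>
    intro e he
    simp only [treeEdges, Finset.mem_insert, Finset.mem_union, BinaryTree.numNodes] at he ⊢
    rcases he with rfl | he | he
    · simp only; omega
    · have := hl a e he; omega
    · have := hr _ e he; omega

theorem treeEdges_base (t : BinaryTree Unit) (a : ℕ) :
    (a, a + t.numNodes + 1) ∈ treeEdges t a := by
  cases t <;> simp [treeEdges, add_assoc]

theorem treeEdges_side (t : BinaryTree Unit) (a : ℕ) :
    ∀ i, a ≤ i → i ≤ a + t.numNodes → (i, i + 1) ∈ treeEdges t a := by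
  induction t generalizing a with
  | nil => intro i h1 h2; simp [treeEdges] at h2 ⊢; omega
  | node x l r hl hr =>
    intro i h1 h2
    simp only [treeEdges, Finset.mem_insert, Finset.mem_union, BinaryTree.numNodes] at h2 ⊢
    by_cases h : i ≤ a + l.numNodes
    · exact Or.inr (Or.inl (hl a i h1 h))
    · exact Or.inr (Or.inr (hr _ i (by omega) (by omega)))

theorem treeEdges_noncrossing (t : BinaryTree Unit) (a : ℕ) :
    ∀ e ∈ treeEdges t a, ∀ f ∈ treeEdges t a, ¬ (e.1 < f.1 ∧ f.1 < e.2 ∧ e.2 < f.2) := by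
  induction t generalizing a with
  | nil =>
    intro e he f hf
    simp only [treeEdges, Finset.mem_singleton] at he hf
    subst he hf
    simp
  | node x l r hl hr =>
    intro e he f hf
    simp only [treeEdges, Finset.mem_insert, Finset.mem_union] at he hf
    rcases he with rfl | he | he <;> rcases hf with rfl | hf | hf
    · simp
    · have := treeEdges_bounds l a f hf; simp only; omega
    · have := treeEdges_bounds r _ f hf; simp only; omega
    · have := treeEdges_bounds l a e he; simp only; omega
    · exact hl a e he f hf
    · have := treeEdges_bounds l a e he
      have := treeEdges_bounds r _ f hf; omega
    · have := treeEdges_bounds r _ e he; simp only; omega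
    · have := treeEdges_bounds r _ e he
      have := treeEdges_bounds l a f hf; omega
    · exact hr _ e he f hf

theorem treeEdges_card (t : BinaryTree Unit) (a : ℕ) :
    (treeEdges t a).card = 2 * t.numNodes + 1 := by
  induction t generalizing a with
  | nil => simp [treeEdges]
  | node x l r hl hr =>
    rw [treeEdges, Finset.card_insert_of_notMem, Finset.card_union_of_disjoint, hl, hr]
    · simp only [BinaryTree.numNodes]; omega
    · rw [Finset.disjoint_left]
      intro e he he'
      have := treeEdges_bounds l a e he
      have := treeEdges_bounds r _ e he'
      omega
    · intro he
      rcases Finset.mem_union.1 he with he | he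
      · have := treeEdges_bounds l a _ he; simp only at this; omega
      · have := treeEdges_bounds r _ _ he; simp only at this; omega

/-- The triangulation of the `(n+2)`-gon that corresponds to a binary tree with `n` vertices. -/
def Triangulation.ofTree {n : ℕ} (t : BinaryTree Unit) (ht : t.numNodes = n) :
    Triangulation n where
  edges := treeEdges t 0
  isEdge e he := by have := treeEdges_bounds t 0 e he; omega
  side_mem i hi := treeEdges_side t 0 i (by omega) (by omega)
  distinguished_mem := by simpa [ht] using treeEdges_base t 0
  noncrossing := treeEdges_noncrossing t 0
  card_eq := by rw [treeEdges_card, ht]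

/-- The binary tree of `Triangulation.ofTree t` is `t`. -/
theorem Triangulation.ofTree_hasTree {n : ℕ} (t : BinaryTree Unit) (ht : t.numNodes = n) :
    (Triangulation.ofTree t ht).HasTree 0 (n + 1) t := by
  suffices h : ∀ (s : BinaryTree Unit) (a : ℕ), treeEdges s a ⊆ treeEdges t 0 →
      (Triangulation.ofTree t ht).HasTree a (a + s.numNodes + 1) s by
    simpa [ht] using h t 0 subset_rfl
  intro s
  induction s with
  | nil => exact fun a _ => .nil a
  | node x l r hl hr =>
    intro a h
    have h1 : treeEdges l a ⊆ treeEdges t 0 := fun e he =>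
      h (by simp [treeEdges, he])
    have h2 : treeEdges r (a + l.numNodes + 1) ⊆ treeEdges t 0 := fun e he =>
      h (by simp [treeEdges, he])
    have e : a + (BinaryTree.node x l r).numNodes + 1
        = a + l.numNodes + 1 + r.numNodes + 1 := by simp only [BinaryTree.numNodes]; omega
    have h3 := h (treeEdges_base (.node x l r) a)
    rw [e] at h3 ⊢
    exact .node ⟨by omega, by omega, h1 (treeEdges_base l a), h2 (treeEdges_base r _), h3⟩
      (hl a h1) (hr _ h2)

/-! ### The map `ψ` -/

/-- The binary tree of a sequence of distinct numbers: the root is the smallest entry, and the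
left and right subtrees are the trees of the entries before it and of the entries after it. -/
def minTree (l : List ℕ) : BinaryTree Unit :=
  if h : l = [] then .nil
  else .node () (minTree (l.take (l.idxOf (l.min h)))) (minTree (l.drop (l.idxOf (l.min h) + 1)))
termination_by l.length
decreasing_by
  · have := List.idxOf_lt_length_of_mem (List.min_mem h)
    simp only [List.length_take]; omega
  · have := List.idxOf_lt_length_of_mem (List.min_mem h)
    simp only [List.length_drop]; omega

theorem numNodes_minTree (l : List ℕ) : (minTree l).numNodes = l.length := by
  induction h : l.length using Nat.strong_induction_on generalizing l with
  | _ m ih =>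
    rw [minTree]
    split_ifs with hl
    · subst hl; simpa using h
    · have := List.idxOf_lt_length_of_mem (List.min_mem hl)
      simp only [BinaryTree.numNodes]
      rw [ih _ (by simp only [List.length_take]; omega) _ rfl,
        ih _ (by simp only [List.length_drop]; omega) _ rfl]
      simp only [List.length_take, List.length_drop]
      omega

/-- The triangulation `ψ(u)` of the `(n+2)`-gon: it corresponds to the binary tree of the
one-line notation `u(1) u(2) ⋯ u(n)`. -/
def psi {n : ℕ} (u : Equiv.Perm (Fin n)) : Triangulation n :=
  Triangulation.ofTree (minTree (List.ofFn fun i => (u i : ℕ)))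
    (by rw [numNodes_minTree, List.length_ofFn])

/-- The longest element `w_0` of the symmetric group on `n` letters, `w_0(i) = n + 1 - i`. -/
def longest (n : ℕ) : Equiv.Perm (Fin n) := Fin.revPerm

end CatalanFan

/-!
Pad the one-line notation of `u` by the value `n` at the positions `0` and `n + 1`. Call `(a, b)` a
chord if the entries between `a` and `b` are smaller than those at `a` and at `b`, and let
`(a_k, b_k)` be the chord whose largest inner entry is at `k`. By the tableau criterion, `z` lies in
`[t(u), t(u) s(n,1)]` if and only if each initial segment of `z` lies, in the order of sorted
multisets, between two windows of the padded sequence. Hence each chord gives a valid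
inequality for `Q = Q_{t(u), t(u)s(n,1)}`, with normal vector `ϖ_b - ϖ_a`. The inequalities of
`(a_k, k)` and `(k, b_k)` add up to more than the one of `(a_k, b_k)` gives, so they are never
equalities at the same point; but one can choose either one for each `k` and find a `z` with all of
the chosen equalities. So `Q` is combinatorially a cube, and its normal fan consists of the cones
that are spanned by at most one of `ϖ_k - ϖ_{a_k}`, `ϖ_{b_k} - ϖ_k` for each `k`. The chords
are the edges of the triangulation `ψ(w_0 u w_0)`, up to the reflection `j ↦ n + 1 - j` of the
polygon, and the automorphism `e_i ↦ -e_{n+2-i}` of `N`, which maps `ϖ_i` to `ϖ_{n+1-i}`, carries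
the one family of vectors to the other.
-/

namespace CatalanFan

/-! ### Domination of multisets of natural numbers -/

section Domination

/-- The multiset of the values of `f` on the interval `[a, b)`. -/
def block {α : Type*} (f : ℕ → α) (a b : ℕ) : Multiset α := (Multiset.Ico a b).map f

theorem block_add_block {α : Type*} (f : ℕ → α) {a b c : ℕ} (hab : a ≤ b) (hbc : b ≤ c) :
    block f a b + block f b c = block f a c := by
  rw [block, block, ← Multiset.map_add, Multiset.Ico_add_Ico_eq_Ico hab hbc, block]

theorem block_self {α : Type*} (f : ℕ → α) (a : ℕ) : block f a a = 0 := by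
  rw [block, Multiset.Ico_self, Multiset.map_zero]

theorem block_singleton {α : Type*} (f : ℕ → α) (a : ℕ) : block f a (a + 1) = {f a} := by
  rw [block, Multiset.Ico, Nat.Ico_succ_singleton, Finset.singleton_val, Multiset.map_singleton]

theorem block_succ_right {α : Type*} (f : ℕ → α) {a b : ℕ} (h : a ≤ b) :
    block f a (b + 1) = f b ::ₘ block f a b := by
  rw [← block_add_block f h (Nat.le_succ b), block_singleton, add_comm, Multiset.singleton_add]

theorem block_succ_left {α : Type*} (f : ℕ → α) {a b : ℕ} (h : a < b) :
    block f a b = f a ::ₘ block f (a + 1) b := by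
  rw [← block_add_block f (Nat.le_succ a) h, block_singleton, Multiset.singleton_add]

theorem block_comp_succ {α : Type*} (f : ℕ → α) (a b : ℕ) :
    block (fun j => f (j + 1)) a b = block f (a + 1) (b + 1) := by
  rw [block, block, ← Multiset.map_add_right_Ico, Multiset.map_map]
  rfl

theorem mem_block {α : Type*} {f : ℕ → α} {a b : ℕ} {x : α} :
    x ∈ block f a b ↔ ∃ j, (a ≤ j ∧ j < b) ∧ f j = x := by
  simp only [block, Multiset.mem_map, Multiset.mem_Ico]

theorem block_congr {α : Type*} {f g : ℕ → α} {a b : ℕ} (h : ∀ j, a ≤ j → j < b → f j = g j) :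
    block f a b = block g a b :=
  Multiset.map_congr rfl fun j hj =>
    h j (Multiset.mem_Ico.1 hj).1 (Multiset.mem_Ico.1 hj).2

/-- The number of elements of `s` that are at least `p`. -/
def countGE (p : ℕ) (s : Multiset ℕ) : ℕ := s.countP (p ≤ ·)

@[simp]
theorem countGE_zero (p : ℕ) : countGE p 0 = 0 := Multiset.countP_zero _

@[simp]
theorem countGE_cons (p a : ℕ) (s : Multiset ℕ) :
    countGE p (a ::ₘ s) = countGE p s + if p ≤ a then 1 else 0 := Multiset.countP_cons ..

@[simp]
theorem countGE_add (p : ℕ) (s t : Multiset ℕ) : countGE p (s + t) = countGE p s + countGE p t :=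
  Multiset.countP_add ..

theorem countGE_eq_zero {p : ℕ} {s : Multiset ℕ} : countGE p s = 0 ↔ ∀ a ∈ s, a < p := by
  simp only [countGE, Multiset.countP_eq_zero, not_le]

theorem sum_eq_sum_countGE {s : Multiset ℕ} {N : ℕ} (h : ∀ a ∈ s, a ≤ N) :
    s.sum = ∑ p ∈ Finset.range N, countGE (p + 1) s := by
  induction s using Multiset.induction with
  | empty => simp
  | cons a s ih =>
    obtain ⟨ha, hs⟩ := Multiset.forall_mem_cons.1 h
    have hfilter : (Finset.range N).filter (· + 1 ≤ a) = Finset.range a := by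
      ext p
      simp only [Finset.mem_filter, Finset.mem_range]
      omega
    simp only [countGE_cons, Finset.sum_add_distrib, ← ih hs, Finset.sum_boole, hfilter,
      Finset.card_range, Multiset.sum_cons, Nat.cast_id, add_comm]

/-- `t` dominates `s`: it has at least as many elements `≥ p` as `s`, for every threshold `p`. For
multisets of the same size this is the entrywise order of the sorted sequences. -/
def Dominated (s t : Multiset ℕ) : Prop := ∀ p, countGE p s ≤ countGE p t

namespace Dominated

variable {s t : Multiset ℕ}

theorem refl (s : Multiset ℕ) : Dominated s s := fun _ => le_rfl

theorem sum_le (h : Dominated s t) : s.sum ≤ t.sum := by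
  have hs : ∀ a ∈ s, a ≤ s.sum + t.sum := fun a ha =>
    (Multiset.single_le_sum (fun _ _ => Nat.zero_le _) a ha).trans (Nat.le_add_right ..)
  have ht : ∀ a ∈ t, a ≤ s.sum + t.sum := fun a ha =>
    (Multiset.single_le_sum (fun _ _ => Nat.zero_le _) a ha).trans (Nat.le_add_left ..)
  calc s.sum = ∑ p ∈ Finset.range (s.sum + t.sum), countGE (p + 1) s := sum_eq_sum_countGE hs
    _ ≤ ∑ p ∈ Finset.range (s.sum + t.sum), countGE (p + 1) t :=
      Finset.sum_le_sum fun p _ => h (p + 1)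
    _ = t.sum := (sum_eq_sum_countGE ht).symm

theorem forall_le (h : Dominated s t) {N : ℕ} (ht : ∀ b ∈ t, b ≤ N) : ∀ a ∈ s, a ≤ N := by
  simp only [← Nat.lt_succ_iff, ← countGE_eq_zero] at ht ⊢
  exact Nat.eq_zero_of_le_zero (ht ▸ h (N + 1))

end Dominated

end Domination

/-! ### Inversions and reduced words -/

section ReducedWords

variable {n : ℕ}

/-- The set of the inversions of a permutation, as pairs of positions. -/
def inversions {m : ℕ} (w : Equiv.Perm (Fin m)) : Finset (Fin m × Fin m) :=
  Finset.univ.filter fun x => x.1 < x.2 ∧ w x.2 < w x.1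

theorem mem_inversions {m : ℕ} {w : Equiv.Perm (Fin m)} {x : Fin m × Fin m} :
    x ∈ inversions w ↔ x.1 < x.2 ∧ w x.2 < w x.1 :=
  Finset.mem_filter_univ x

theorem inversions_one (m : ℕ) : inversions (1 : Equiv.Perm (Fin m)) = ∅ :=
  Finset.filter_eq_empty_iff.2 fun _ _ h => h.1.asymm h.2

theorem simpleTransposition_castSucc (i : Fin n) : simpleTransposition i i.castSucc = i.succ :=
  Equiv.swap_apply_left ..

theorem simpleTransposition_succ (i : Fin n) : simpleTransposition i i.succ = i.castSucc :=
  Equiv.swap_apply_right ..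

theorem simpleTransposition_mul_self (i : Fin n) :
    simpleTransposition i * simpleTransposition i = 1 := Equiv.swap_mul_self ..

theorem mul_simpleTransposition_mul_self (w : Equiv.Perm (Fin (n + 1))) (i : Fin n) :
    w * simpleTransposition i * simpleTransposition i = w := by
  rw [mul_assoc, simpleTransposition_mul_self, mul_one]

theorem simpleTransposition_apply_self (i : Fin n) (a : Fin (n + 1)) :
    simpleTransposition i (simpleTransposition i a) = a := by
  rw [← Equiv.Perm.mul_apply, simpleTransposition_mul_self, Equiv.Perm.one_apply]

theorem simpleTransposition_lt (i : Fin n) {a b : Fin (n + 1)} (h : a < b)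
    (h' : ¬ (a = i.castSucc ∧ b = i.succ)) :
    simpleTransposition i a < simpleTransposition i b := by
  simp only [Fin.lt_def, Fin.ext_iff, Fin.val_castSucc, Fin.val_succ] at h h'
  simp only [simpleTransposition, Equiv.swap_apply_def, Fin.ext_iff, Fin.val_castSucc,
    Fin.val_succ]
  split_ifs <;> simp only [Fin.lt_def, Fin.val_castSucc, Fin.val_succ] <;> omega

theorem ascent_or_descent (w : Equiv.Perm (Fin (n + 1))) (i : Fin n) :
    w i.castSucc < w i.succ ∨ w i.succ < w i.castSucc :=
  lt_or_gt_of_ne (w.injective.ne Fin.castSucc_lt_succ.ne)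

theorem mem_inversions_mul_of_ascent {w : Equiv.Perm (Fin (n + 1))} {i : Fin n}
    (h : w i.castSucc < w i.succ) {a b : Fin (n + 1)} :
    (a, b) ∈ inversions (w * simpleTransposition i) ↔ (a, b) = (i.castSucc, i.succ) ∨
      (simpleTransposition i a, simpleTransposition i b) ∈ inversions w := by
  simp only [mem_inversions, Equiv.Perm.mul_apply, Prod.mk.injEq]
  constructor
  · rintro ⟨hab, hw⟩
    by_cases hi : a = i.castSucc ∧ b = i.succ
    · exact Or.inl hi
    · exact Or.inr ⟨simpleTransposition_lt i hab hi, hw⟩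
  · rintro (⟨rfl, rfl⟩ | ⟨hab, hw⟩)
    · rw [simpleTransposition_castSucc, simpleTransposition_succ]
      exact ⟨Fin.castSucc_lt_succ, h⟩
    · refine ⟨?_, hw⟩
      have := simpleTransposition_lt i hab fun hi => (hi.1 ▸ hi.2 ▸ hw).asymm h
      rwa [simpleTransposition_apply_self, simpleTransposition_apply_self] at this

theorem card_inversions_mul_of_ascent {w : Equiv.Perm (Fin (n + 1))} {i : Fin n}
    (h : w i.castSucc < w i.succ) :
    (inversions (w * simpleTransposition i)).card = (inversions w).card + 1 := by
  have hsymm : (simpleTransposition i).symm = simpleTransposition i := Equiv.symm_swap ..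
  have hinv : inversions (w * simpleTransposition i) = insert (i.castSucc, i.succ)
      ((inversions w).map
        ((simpleTransposition i).prodCongr (simpleTransposition i)).toEmbedding) := by
    ext ⟨a, b⟩
    rw [mem_inversions_mul_of_ascent h, Finset.mem_insert, Finset.mem_map_equiv,
      Equiv.prodCongr_symm, hsymm, Equiv.prodCongr_apply, Prod.map]
  rw [hinv, Finset.card_insert_of_notMem, Finset.card_map]
  rw [Finset.mem_map_equiv, Equiv.prodCongr_symm, hsymm, Equiv.prodCongr_apply, Prod.map,
    simpleTransposition_castSucc, simpleTransposition_succ, mem_inversions]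
  exact fun hi => hi.1.asymm Fin.castSucc_lt_succ

theorem card_inversions_mul_of_descent {w : Equiv.Perm (Fin (n + 1))} {i : Fin n}
    (h : w i.succ < w i.castSucc) :
    (inversions w).card = (inversions (w * simpleTransposition i)).card + 1 := by
  rw [← card_inversions_mul_of_ascent (i := i), mul_simpleTransposition_mul_self]
  simpa only [Equiv.Perm.mul_apply, simpleTransposition_castSucc, simpleTransposition_succ]

theorem wordProd_append_singleton (ω : List (Fin n)) (i : Fin n) :
    wordProd (ω ++ [i]) = wordProd ω * simpleTransposition i := by
  simp [wordProd]

theorem card_inversions_wordProd_le (ω : List (Fin n)) :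
    (inversions (wordProd ω)).card ≤ ω.length := by
  induction ω using List.reverseRecOn with
  | nil => exact (congrArg Finset.card (inversions_one (n + 1))).le
  | append_singleton ω i ih =>
    rw [wordProd_append_singleton, List.length_append, List.length_singleton]
    rcases ascent_or_descent (wordProd ω) i with h | h
    · rw [card_inversions_mul_of_ascent h]; omega
    · rw [card_inversions_mul_of_descent h] at ih; omega

theorem eq_one_of_forall_ascent {w : Equiv.Perm (Fin (n + 1))}
    (h : ∀ i : Fin n, w i.castSucc < w i.succ) : w = 1 := by
  have hmono : StrictMono w := Fin.strictMono_iff_lt_succ.2 h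
  have heq : hmono.orderIsoOfSurjective w w.surjective = OrderIso.refl _ := Subsingleton.elim _ _
  exact Equiv.ext fun x => DFunLike.congr_fun heq x

theorem exists_descent_of_ne_one {w : Equiv.Perm (Fin (n + 1))} (h : w ≠ 1) :
    ∃ i : Fin n, w i.succ < w i.castSucc := by
  contrapose! h
  exact eq_one_of_forall_ascent fun i => (ascent_or_descent w i).resolve_right (h i).not_gt

theorem exists_wordProd_eq (w : Equiv.Perm (Fin (n + 1))) :
    ∃ ω : List (Fin n), wordProd ω = w ∧ ω.length = (inversions w).card := by
  induction h : (inversions w).card using Nat.strong_induction_on generalizing w with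
  | _ m ih =>
    by_cases hw : w = 1
    · exact ⟨[], hw.symm, by rw [← h, hw, inversions_one]; rfl⟩
    · obtain ⟨i, hi⟩ := exists_descent_of_ne_one hw
      have hcard := card_inversions_mul_of_descent hi
      obtain ⟨ω, hprod, hlen⟩ := ih _ (by omega) (w * simpleTransposition i) rfl
      refine ⟨ω ++ [i], ?_, ?_⟩
      · rw [wordProd_append_singleton, hprod, mul_simpleTransposition_mul_self]
      · rw [List.length_append, hlen, List.length_singleton]; omega

theorem isReducedWord_iff {ω : List (Fin n)} {w : Equiv.Perm (Fin (n + 1))} :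
    IsReducedWord ω w ↔ wordProd ω = w ∧ ω.length = (inversions w).card := by
  refine and_congr_right fun hprod => ⟨fun hmin => le_antisymm ?_ ?_, ?_⟩
  · obtain ⟨ω', hprod', hlen⟩ := exists_wordProd_eq w
    exact (hmin ω' hprod').trans_eq hlen
  · exact hprod ▸ card_inversions_wordProd_le ω
  · rintro hlen ω' rfl
    exact hlen.trans_le (card_inversions_wordProd_le ω')

theorem IsReducedWord.append_of_ascent {ω : List (Fin n)} {w : Equiv.Perm (Fin (n + 1))}
    {i : Fin n} (hω : IsReducedWord ω w) (h : w i.castSucc < w i.succ) :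
    IsReducedWord (ω ++ [i]) (w * simpleTransposition i) := by
  rw [isReducedWord_iff] at hω ⊢
  rw [wordProd_append_singleton, hω.1, List.length_append, hω.2, card_inversions_mul_of_ascent h]
  exact ⟨rfl, rfl⟩

theorem IsReducedWord.append_of_descent {ω : List (Fin n)} {w : Equiv.Perm (Fin (n + 1))}
    {i : Fin n} (hω : IsReducedWord ω (w * simpleTransposition i))
    (h : w i.succ < w i.castSucc) : IsReducedWord (ω ++ [i]) w := by
  rw [← mul_simpleTransposition_mul_self w i]
  refine hω.append_of_ascent ?_
  simpa only [Equiv.Perm.mul_apply, simpleTransposition_castSucc, simpleTransposition_succ]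

theorem IsReducedWord.of_append {ω : List (Fin n)} {i : Fin n}
    (h : IsReducedWord (ω ++ [i]) (wordProd (ω ++ [i]))) :
    IsReducedWord ω (wordProd ω) ∧ wordProd ω i.castSucc < wordProd ω i.succ := by
  have hlen := (isReducedWord_iff.1 h).2
  rw [wordProd_append_singleton, List.length_append, List.length_singleton] at hlen
  have hle := card_inversions_wordProd_le ω
  have hasc := (ascent_or_descent (wordProd ω) i).resolve_right fun hdesc => by
    have := card_inversions_mul_of_descent hdesc
    omega
  rw [card_inversions_mul_of_ascent hasc] at hlen
  exact ⟨isReducedWord_iff.2 ⟨rfl, Nat.succ_injective hlen⟩, hasc⟩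

end ReducedWords

/-! ### The rank criterion for the Bruhat order -/

section RankCriterion

variable {n : ℕ}

/-- The one-line notation of a permutation as a function on `ℕ`, with the junk value `0` outside
its range of definition. -/
def oneLine (w : Equiv.Perm (Fin (n + 1))) (j : ℕ) : ℕ :=
  if h : j < n + 1 then w ⟨j, h⟩ else 0

theorem oneLine_of_lt (w : Equiv.Perm (Fin (n + 1))) {j : ℕ} (h : j < n + 1) :
    oneLine w j = w ⟨j, h⟩ := dif_pos h

theorem oneLine_castSucc (w : Equiv.Perm (Fin (n + 1))) (i : Fin n) :
    oneLine w i = w i.castSucc := oneLine_of_lt w i.castSucc.2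

theorem oneLine_succ (w : Equiv.Perm (Fin (n + 1))) (i : Fin n) :
    oneLine w (i + 1) = w i.succ := oneLine_of_lt w i.succ.2

theorem oneLine_mul_castSucc (w : Equiv.Perm (Fin (n + 1))) (i : Fin n) :
    oneLine (w * simpleTransposition i) i = oneLine w (i + 1) := by
  rw [oneLine_castSucc, oneLine_succ, Equiv.Perm.mul_apply, simpleTransposition_castSucc]

theorem oneLine_mul_succ (w : Equiv.Perm (Fin (n + 1))) (i : Fin n) :
    oneLine (w * simpleTransposition i) (i + 1) = oneLine w i := by
  rw [oneLine_castSucc, oneLine_succ, Equiv.Perm.mul_apply, simpleTransposition_succ]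

theorem oneLine_mul_of_ne (w : Equiv.Perm (Fin (n + 1))) {i : Fin n} {j : ℕ} (hi : j ≠ i)
    (hi' : j ≠ i + 1) : oneLine (w * simpleTransposition i) j = oneLine w j := by
  rw [oneLine, oneLine]
  split_ifs with hj
  · rw [Equiv.Perm.mul_apply, simpleTransposition, Equiv.swap_apply_of_ne_of_ne] <;>
      simpa [Fin.ext_iff]
  · rfl

theorem block_oneLine_mul_of_le (w : Equiv.Perm (Fin (n + 1))) {i : Fin n} {k : ℕ}
    (hk : k ≤ i) : block (oneLine (w * simpleTransposition i)) 0 k = block (oneLine w) 0 k :=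
  block_congr fun _ _ hj => oneLine_mul_of_ne w (by omega) (by omega)

theorem block_oneLine_mul_succ (w : Equiv.Perm (Fin (n + 1))) (i : Fin n) :
    block (oneLine (w * simpleTransposition i)) 0 (i + 1) =
      oneLine w (i + 1) ::ₘ block (oneLine w) 0 i := by
  rw [block_succ_right _ (Nat.zero_le _), oneLine_mul_castSucc, block_oneLine_mul_of_le w le_rfl]

theorem block_oneLine_mul_of_ne (w : Equiv.Perm (Fin (n + 1))) {i : Fin n} {k : ℕ}
    (hk : k ≠ i + 1) :
    block (oneLine (w * simpleTransposition i)) 0 k = block (oneLine w) 0 k := by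
  rcases lt_or_gt_of_ne hk with h | h
  · exact block_oneLine_mul_of_le w (Nat.lt_succ_iff.1 h)
  · have hleft : block (oneLine (w * simpleTransposition i)) 0 (i + 1 + 1) =
        block (oneLine w) 0 (i + 1 + 1) := by
      rw [block_succ_right _ (Nat.zero_le _), block_oneLine_mul_succ, oneLine_mul_succ,
        block_succ_right _ (Nat.zero_le _), block_succ_right _ (Nat.zero_le _),
        Multiset.cons_swap]
    rw [← block_add_block _ (Nat.zero_le _) h, ← block_add_block (oneLine w) (Nat.zero_le _) h,
      hleft, block_congr fun j hj _ => oneLine_mul_of_ne w (by omega) (by omega)]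

/-- The tableau criterion: every initial segment of the one-line notation of `w` dominates the one
of `v`. -/
def RankLE (v w : Equiv.Perm (Fin (n + 1))) : Prop :=
  ∀ k ≤ n + 1, Dominated (block (oneLine v) 0 k) (block (oneLine w) 0 k)

namespace RankLE

variable {v w : Equiv.Perm (Fin (n + 1))}

/-- Two instances of the lifting property. The segments of `v` and `w` of length `i + 1` change; the
comparison of the new ones follows from those of the old segments of lengths `i` and `i + 2`. -/
theorem mul_mul (h : RankLE v w) {i : Fin n}
    (hi : w i.castSucc < w i.succ ∨ v i.succ < v i.castSucc) :
    RankLE (v * simpleTransposition i) (w * simpleTransposition i) := by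
  intro k hk
  rcases eq_or_ne k (i + 1) with rfl | hki
  · intro p
    have hshort := h i (by omega) p
    have hlong := h (i + 1 + 1) (by omega) p
    simp only [Fin.lt_def, ← oneLine_castSucc, ← oneLine_succ] at hi
    rw [block_oneLine_mul_succ, block_oneLine_mul_succ]
    simp only [block_succ_right _ (Nat.zero_le _), countGE_cons] at hlong ⊢
    split_ifs at hlong ⊢ <;> omega
  · rw [block_oneLine_mul_of_ne v hki, block_oneLine_mul_of_ne w hki]
    exact h k hk

theorem le_mul (h : RankLE v w) {i : Fin n}
    (hi : w i.castSucc < w i.succ ∨ v i.castSucc < v i.succ) :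
    RankLE v (w * simpleTransposition i) := by
  intro k hk
  rcases eq_or_ne k (i + 1) with rfl | hki
  · intro p
    have hshort := h i (by omega) p
    have hmiddle := h (i + 1) hk p
    have hlong := h (i + 1 + 1) (by omega) p
    simp only [Fin.lt_def, ← oneLine_castSucc, ← oneLine_succ] at hi
    rw [block_oneLine_mul_succ]
    simp only [block_succ_right _ (Nat.zero_le _), countGE_cons] at hmiddle hlong ⊢
    split_ifs at hmiddle hlong ⊢ <;> omega
  · rw [block_oneLine_mul_of_ne w hki]
    exact h k hk

theorem eq_one (h : RankLE v 1) : v = 1 := by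
  have hle : ∀ x : Fin (n + 1), (v x : ℕ) ≤ x := by
    intro x
    have hone : ∀ b ∈ block (oneLine (1 : Equiv.Perm (Fin (n + 1)))) 0 (x + 1), b ≤ x := by
      intro b hb
      obtain ⟨j, ⟨-, hjx⟩, rfl⟩ := mem_block.1 hb
      rw [oneLine_of_lt _ (by omega)]
      exact Nat.lt_succ_iff.1 hjx
    refine (h (x + 1) x.2).forall_le hone _ (mem_block.2 ⟨x, ?_, oneLine_of_lt v x.2⟩)
    exact ⟨Nat.zero_le _, Nat.lt_succ_self _⟩
  have hsum : ∑ x, (v x : ℕ) = ∑ x : Fin (n + 1), (x : ℕ) :=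
    Equiv.sum_comp v (fun x => (x : ℕ))
  have heq := (Finset.sum_eq_sum_iff_of_le fun x _ => hle x).1 hsum
  exact Equiv.ext fun x => Fin.ext (heq x (Finset.mem_univ x))

theorem of_sublist {ω ω' : List (Fin n)} (hω : IsReducedWord ω (wordProd ω))
    (h : ω'.Sublist ω) : RankLE (wordProd ω') (wordProd ω) := by
  induction ω using List.reverseRecOn generalizing ω' with
  | nil => rw [List.sublist_nil.1 h]; exact fun _ _ => .refl _
  | append_singleton ω i ih =>
    obtain ⟨hred, hasc⟩ := hω.of_append
    obtain ⟨ω₁, ω₂, rfl, h₁, h₂⟩ := List.sublist_append_iff.1 h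
    have hle := ih hred h₁
    rw [wordProd_append_singleton]
    rcases List.sublist_singleton.1 h₂ with rfl | rfl
    · rw [List.append_nil]
      exact hle.le_mul (Or.inl hasc)
    · rw [wordProd_append_singleton]
      exact hle.mul_mul (Or.inl hasc)

theorem bruhatLE (h : RankLE v w) : BruhatLE v w := by
  induction hm : (inversions w).card using Nat.strong_induction_on generalizing v w with
  | _ m ih =>
    by_cases hw : w = 1
    · subst hw
      obtain rfl := h.eq_one
      obtain ⟨ω, hω⟩ := exists_wordProd_eq (1 : Equiv.Perm (Fin (n + 1)))
      exact ⟨ω, ω, isReducedWord_iff.2 hω, isReducedWord_iff.2 hω, .refl _⟩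
    · obtain ⟨i, hi⟩ := exists_descent_of_ne_one hw
      have hcard := card_inversions_mul_of_descent hi
      rcases ascent_or_descent v i with hv | hv
      · obtain ⟨ω', ω, hω', hω, hsub⟩ := ih _ (by omega) (h.le_mul (Or.inr hv)) rfl
        exact ⟨ω', ω ++ [i], hω', hω.append_of_descent hi,
          hsub.trans (List.sublist_append_left ..)⟩
      · obtain ⟨ω', ω, hω', hω, hsub⟩ := ih _ (by omega) (h.mul_mul (Or.inr hv)) rfl
        exact ⟨ω' ++ [i], ω ++ [i], hω'.append_of_descent hv, hω.append_of_descent hi,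
          hsub.append (.refl _)⟩

end RankLE

theorem bruhatLE_iff_rankLE {v w : Equiv.Perm (Fin (n + 1))} : BruhatLE v w ↔ RankLE v w := by
  refine ⟨?_, RankLE.bruhatLE⟩
  rintro ⟨ω', ω, hω', hω, hsub⟩
  rw [← hω'.1, ← hω.1]
  exact .of_sublist (hω.1 ▸ hω) hsub

end RankCriterion

/-! ### The interval `[t(u), t(u) s(n,1)]` -/

section Interval

variable {n : ℕ}

theorem wordProd_reverse_take_finRange_apply (m : ℕ) (hm : m ≤ n) (j : Fin (n + 1)) :
    (wordProd ((List.finRange n).take m).reverse j : ℕ) =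
      if (j : ℕ) = 0 then m else if (j : ℕ) ≤ m then (j : ℕ) - 1 else j := by
  induction m generalizing j with
  | zero =>
    simp only [List.take_zero, List.reverse_nil, wordProd, List.map_nil, List.prod_nil,
      Equiv.Perm.one_apply]
    split_ifs <;> omega
  | succ m ih =>
    have htake : (List.finRange n).take (m + 1) = (List.finRange n).take m ++ [⟨m, hm⟩] := by
      rw [List.take_succ_eq_append_getElem (by simpa using hm), List.getElem_finRange]
      rfl
    have hj := ih (Nat.le_of_succ_le hm) j
    rw [htake, List.reverse_append, List.reverse_singleton, List.singleton_append, wordProd,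
      List.map_cons, List.prod_cons, Equiv.Perm.mul_apply, ← wordProd, simpleTransposition,
      Equiv.swap_apply_def]
    simp only [Fin.ext_iff, Fin.val_castSucc, Fin.val_succ]
    split_ifs at hj ⊢ <;> (try simp only [Fin.val_succ, Fin.val_castSucc]) <;> omega

theorem sDown_apply (j : Fin (n + 1)) :
    (sDown n j : ℕ) = if (j : ℕ) = 0 then n else (j : ℕ) - 1 := by
  have h := wordProd_reverse_take_finRange_apply n le_rfl j
  rw [List.take_of_length_le (List.length_finRange ..).le] at h
  rw [sDown, h]
  split_ifs <;> omega

/-- The one-line notation of `u` at the positions `1, …, n`, with the value `n` (which exceeds all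
its entries, as these lie in `Fin n`) at all other positions. The one-line notations of `t(u)` and
of `t(u) s(n,1)` are its windows `1, …, n + 1` and `0, …, n`. -/
def paddedSeq (u : Equiv.Perm (Fin n)) (j : ℕ) : ℕ :=
  if h : 1 ≤ j ∧ j ≤ n then u ⟨j - 1, by omega⟩ else n

theorem paddedSeq_of_not (u : Equiv.Perm (Fin n)) {j : ℕ} (h : ¬ (1 ≤ j ∧ j ≤ n)) :
    paddedSeq u j = n := dif_neg h

theorem paddedSeq_zero (u : Equiv.Perm (Fin n)) : paddedSeq u 0 = n :=
  paddedSeq_of_not u (by omega)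

theorem paddedSeq_last (u : Equiv.Perm (Fin n)) : paddedSeq u (n + 1) = n :=
  paddedSeq_of_not u (by omega)

theorem paddedSeq_lt (u : Equiv.Perm (Fin n)) {j : ℕ} (h : 0 < j) (h' : j < n + 1) :
    paddedSeq u j < n := by
  rw [paddedSeq, dif_pos ⟨h, Nat.lt_succ_iff.1 h'⟩]
  exact (u _).2

theorem paddedSeq_le (u : Equiv.Perm (Fin n)) (j : ℕ) : paddedSeq u j ≤ n := by
  by_cases h : 0 < j ∧ j < n + 1
  · exact (paddedSeq_lt u h.1 h.2).le
  · exact (paddedSeq_of_not u (by omega)).le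

theorem injOn_paddedSeq (u : Equiv.Perm (Fin n)) : Set.InjOn (paddedSeq u) (Set.Ioo 0 (n + 1)) := by
  rintro i ⟨hi, hi'⟩ j ⟨hj, hj'⟩ h
  rw [paddedSeq, dif_pos (by omega), paddedSeq, dif_pos (by omega), Fin.val_inj,
    u.injective.eq_iff, Fin.mk.injEq] at h
  omega

theorem oneLine_addTail (u : Equiv.Perm (Fin n)) {j : ℕ} (hj : j < n + 1) :
    oneLine (addTail u) j = paddedSeq u (j + 1) := by
  rw [oneLine_of_lt _ hj]
  rcases (Nat.lt_succ_iff.1 hj).lt_or_eq with h | rfl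
  · rw [paddedSeq, dif_pos (by omega)]
    exact congrArg Fin.val (addTail_castSucc u ⟨j, h⟩)
  · rw [paddedSeq_last]
    exact congrArg Fin.val (addTail_last u)

theorem oneLine_addTail_mul_sDown (u : Equiv.Perm (Fin n)) {j : ℕ} (hj : j < n + 1) :
    oneLine (addTail u * sDown n) j = paddedSeq u j := by
  have hs := sDown_apply (⟨j, hj⟩ : Fin (n + 1))
  rw [oneLine_of_lt _ hj, Equiv.Perm.mul_apply, ← oneLine_of_lt (addTail u) (Fin.is_lt _),
    oneLine_addTail _ (Fin.is_lt _), hs]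
  split_ifs with h0
  · rw [paddedSeq_last, paddedSeq_of_not _ (by simp only at h0; omega)]
  · rw [Nat.sub_add_cancel (Nat.pos_of_ne_zero h0)]

/-- The first `k` entries of `z` lie between the windows of length `k` of `U` that start at the
positions `1` and `0`, for every `k ≤ n + 1`. -/
def SegmentBounds (n : ℕ) (U z : ℕ → ℕ) : Prop :=
  ∀ k ≤ n + 1, Dominated (block U 1 (k + 1)) (block z 0 k) ∧
    Dominated (block z 0 k) (block U 0 k)

theorem mem_interval_iff (u : Equiv.Perm (Fin n)) (z : Equiv.Perm (Fin (n + 1))) :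
    BruhatLE (addTail u) z ∧ BruhatLE z (addTail u * sDown n) ↔
      SegmentBounds n (paddedSeq u) (oneLine z) := by
  have hlower : ∀ k ≤ n + 1, block (oneLine (addTail u)) 0 k = block (paddedSeq u) 1 (k + 1) := by
    intro k hk
    rw [← block_comp_succ]
    exact block_congr fun j _ hj => oneLine_addTail u (by omega)
  have hupper : ∀ k ≤ n + 1, block (oneLine (addTail u * sDown n)) 0 k =
      block (paddedSeq u) 0 k :=
    fun k hk => block_congr fun j _ hj => oneLine_addTail_mul_sDown u (by omega)
  rw [bruhatLE_iff_rankLE, bruhatLE_iff_rankLE, RankLE, RankLE, ← forall₂_and]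
  refine forall₂_congr fun k hk => ?_
  rw [hlower k hk, hupper k hk]

end Interval

/-! ### Chords of a sequence -/

section Chords

/-- `(a, b)` is a chord of `V` if the entries strictly between the positions `a` and `b` are smaller
than those at `a` and `b`. The chords of a sequence with distinct entries and large ends are the
edges of the triangulation that corresponds to its decreasing binary tree. -/
def IsChord {α : Type*} [Preorder α] (V : ℕ → α) (a b : ℕ) : Prop :=
  a < b ∧ ∀ i, a < i → i < b → V i < V a ∧ V i < V b

/-- `k` is the position of the largest entry strictly inside the chord `(a, b)`; in the
triangulation, `a < k < b` is the triangle below the edge `{a, b}`. -/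
structure IsApex {α : Type*} [Preorder α] (V : ℕ → α) (a k b : ℕ) : Prop where
  chord : IsChord V a b
  left_lt : a < k
  lt_right : k < b
  lt_apex : ∀ i, a < i → i < b → i ≠ k → V i < V k

variable {α : Type*} [Preorder α] {V : ℕ → α} {a b k l r : ℕ}

theorem isChord_succ (V : ℕ → α) (a : ℕ) : IsChord V a (a + 1) :=
  ⟨Nat.lt_succ_self a, fun _ h h' => by omega⟩

theorem IsApex.lt_left (h : IsApex V a k b) : V k < V a := (h.chord.2 k h.left_lt h.lt_right).1

theorem IsApex.apex_lt_right (h : IsApex V a k b) : V k < V b :=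
  (h.chord.2 k h.left_lt h.lt_right).2

theorem IsApex.chord_left (h : IsApex V a k b) : IsChord V a k :=
  ⟨h.left_lt, fun i hi hi' =>
    ⟨(h.chord.2 i hi (hi'.trans h.lt_right)).1, h.lt_apex i hi (hi'.trans h.lt_right) hi'.ne⟩⟩

theorem IsApex.chord_right (h : IsApex V a k b) : IsChord V k b :=
  ⟨h.lt_right, fun i hi hi' =>
    ⟨h.lt_apex i (h.left_lt.trans hi) hi' hi.ne', (h.chord.2 i (h.left_lt.trans hi) hi').2⟩⟩

theorem IsChord.eq_or_le_or_le (h : IsChord V a b) (hl : l ≤ a) (hr : b ≤ r)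
    (hk : ∀ i, l < i → i < r → i ≠ k → V i < V k) : (a = l ∧ b = r) ∨ b ≤ k ∨ k ≤ a := by
  by_contra! hne
  obtain ⟨hends, hkb, hak⟩ := hne
  obtain ⟨hVa, hVb⟩ := h.2 k hak hkb
  have ha : a = l := by
    by_contra hla
    exact (hk a (by omega) (by omega) hak.ne).asymm hVa
  exact hends ha (by_contra fun hbr => (hk b (by omega) (by omega) hkb.ne').asymm hVb)

theorem IsApex.eq_of_forall_lt (h : IsApex V a k b) {m : ℕ} (ham : a < m) (hmb : m < b)
    (hm : ∀ i, a < i → i < b → i ≠ m → V i < V m) : m = k := by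
  by_contra hne
  exact (h.lt_apex m ham hmb hne).asymm (hm k h.left_lt h.lt_right (Ne.symm hne))

theorem IsApex.unique {a' b' : ℕ} (h : IsApex V a k b) (h' : IsApex V a' k b') :
    a = a' ∧ b = b' := by
  have hak := h.left_lt
  have hkb := h.lt_right
  have hak' := h'.left_lt
  have hkb' := h'.lt_right
  constructor
  · rcases lt_trichotomy a a' with ha | ha | ha
    · exact ((h.lt_apex a' ha (by omega) (by omega)).asymm h'.lt_left).elim
    · exact ha
    · exact ((h'.lt_apex a ha (by omega) (by omega)).asymm h.lt_left).elim
  · rcases lt_trichotomy b b' with hb | hb | hb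
    · exact ((h'.lt_apex b (by omega) hb (by omega)).asymm h.apex_lt_right).elim
    · exact hb
    · exact ((h.lt_apex b' (by omega) hb (by omega)).asymm h'.apex_lt_right).elim

theorem IsApex.reflect {N : ℕ} (h : IsApex V a k b) (hb : b ≤ N) :
    IsApex (fun j => V (N - j)) (N - b) (N - k) (N - a) := by
  have hak := h.left_lt
  have hkb := h.lt_right
  refine ⟨⟨by omega, fun i hi hi' => ?_⟩, by omega, by omega, fun i hi hi' hik => ?_⟩
  · dsimp only
    rw [Nat.sub_sub_self hb, Nat.sub_sub_self (by omega)]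
    exact (h.chord.2 (N - i) (by omega) (by omega)).symm
  · rw [Nat.sub_sub_self (by omega)]
    exact h.lt_apex (N - i) (by omega) (by omega) (by omega)

end Chords

theorem exists_forall_lt_of_injOn {α : Type*} [LinearOrder α] {V : ℕ → α} {a b : ℕ}
    (hab : a + 1 < b) (hinj : Set.InjOn V (Set.Ioo a b)) :
    ∃ k, a < k ∧ k < b ∧ ∀ i, a < i → i < b → i ≠ k → V i < V k := by
  obtain ⟨k, hk, hmax⟩ := Finset.exists_max_image (Finset.Ioo a b) V
    ⟨a + 1, Finset.mem_Ioo.2 ⟨Nat.lt_succ_self a, hab⟩⟩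
  rw [Finset.mem_Ioo] at hk
  exact ⟨k, hk.1, hk.2, fun i hai hib hik =>
    (hmax i (Finset.mem_Ioo.2 ⟨hai, hib⟩)).lt_of_ne (hinj.ne ⟨hai, hib⟩ hk hik)⟩

theorem exists_isApex_of_injOn {α : Type*} [LinearOrder α] {V : ℕ → α} {k l r : ℕ}
    (hlk : l < k) (hkr : k < r) (hl : V k < V l) (hr : V k < V r)
    (hinj : Set.InjOn V (Set.Ioo l r)) :
    ∃ a b, IsApex V a k b ∧ b ≤ r := by
  classical
  obtain ⟨a, ⟨hla, hak, ha⟩, hamax⟩ : ∃ a, (l ≤ a ∧ a < k ∧ V k < V a) ∧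
      ∀ i, a < i → i < k → V i ≤ V k := by
    obtain ⟨a, ha, hamax⟩ := Finset.exists_max_image {a ∈ Finset.Ico l k | V k < V a} id
      ⟨l, by simp [hlk, hl]⟩
    simp only [Finset.mem_filter, Finset.mem_Ico, id] at ha hamax
    exact ⟨a, ⟨ha.1.1, ha.1.2, ha.2⟩, fun i hai hik =>
      not_lt.1 fun hi => hai.not_ge (hamax i ⟨⟨by omega, hik⟩, hi⟩)⟩
  have hex : ∃ b, k < b ∧ V k < V b := ⟨r, hkr, hr⟩
  obtain ⟨hkb, hb⟩ := Nat.find_spec hex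
  have hbr : Nat.find hex ≤ r := Nat.find_min' hex ⟨hkr, hr⟩
  have hlt : ∀ i, a < i → i < Nat.find hex → i ≠ k → V i < V k := fun i hai hib hik => by
    refine lt_of_le_of_ne ?_ fun heq => hik (hinj ⟨by omega, by omega⟩ ⟨hlk, hkr⟩ heq)
    rcases hik.lt_or_gt with hik | hki
    · exact hamax i hai hik
    · exact not_lt.1 fun hi => Nat.find_min hex hib ⟨hki, hi⟩
  refine ⟨a, Nat.find hex, ⟨⟨hak.trans hkb, fun i hai hib => ?_⟩, hak, hkb, hlt⟩, hbr⟩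
  rcases eq_or_ne i k with rfl | hik
  · exact ⟨ha, hb⟩
  · exact ⟨(hlt i hai hib hik).trans ha, (hlt i hai hib hik).trans hb⟩

/-! ### The facet inequalities -/

section ChordBlock

variable {n a b k : ℕ} {U z : ℕ → ℕ}

/-- A lower bound, in the sense of `Dominated`, for the entries at the positions `a, …, b - 1` of a
member of the interval, if `(a, b)` is a chord of `U`. -/
def chordBlock (U : ℕ → ℕ) (a b : ℕ) : Multiset ℕ := min (U a) (U b) ::ₘ block U (a + 1) b

theorem IsApex.chordBlock_left (h : IsApex U a k b) :
    chordBlock U a k = U k ::ₘ block U (a + 1) k := by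
  rw [chordBlock, min_eq_right h.lt_left.le]

theorem IsApex.chordBlock_right (h : IsApex U a k b) :
    chordBlock U k b = U k ::ₘ block U (k + 1) b := by
  rw [chordBlock, min_eq_left h.apex_lt_right.le]

theorem IsApex.sum_chordBlock_lt (h : IsApex U a k b) :
    (chordBlock U a k).sum + (chordBlock U k b).sum < (chordBlock U a b).sum := by
  have hmin : U k < min (U a) (U b) := lt_min h.lt_left h.apex_lt_right
  rw [h.chordBlock_left, h.chordBlock_right, chordBlock, ← block_add_block U
    (Nat.add_one_le_of_lt h.left_lt) h.lt_right.le, block_succ_left U h.lt_right]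
  simp only [Multiset.sum_cons, Multiset.sum_add]
  omega

theorem SegmentBounds.dominated_chordBlock (h : SegmentBounds n U z) (hU : ∀ j, U j ≤ U 0)
    (hab : IsChord U a b) (hb : b ≤ n + 1) : Dominated (chordBlock U a b) (block z a b) := by
  intro p
  by_cases hp : p ≤ U a ∧ p ≤ U b
  · have hlower := (h b hb).1 p
    have hupper := (h a (hab.1.le.trans hb)).2 p
    have hz := congrArg (countGE p) (block_add_block z (Nat.zero_le a) hab.1.le)
    have hU₀ := congrArg (countGE p) (block_succ_left U (Nat.add_one_pos b))
    have hUb := congrArg (countGE p) (block_succ_right U (Nat.zero_le b))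
    have hUa := congrArg (countGE p) (block_add_block U (Nat.zero_le a) hab.1.le)
    rw [block_succ_left U hab.1] at hUa
    simp only [countGE_add, countGE_cons, chordBlock, if_pos (le_min hp.1 hp.2), if_pos hp.1,
      if_pos hp.2, if_pos (hp.1.trans (hU a)), zero_add] at *
    omega
  · have hzero : countGE p (chordBlock U a b) = 0 := by
      rw [countGE_eq_zero, chordBlock, Multiset.forall_mem_cons]
      refine ⟨by omega, fun x hx => ?_⟩
      obtain ⟨i, ⟨hai, hib⟩, rfl⟩ := mem_block.1 hx
      have := hab.2 i hai hib
      omega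
    exact hzero ▸ Nat.zero_le _

end ChordBlock

/-! ### Members of the interval with prescribed equalities -/

section Filling

variable {n l k r a b M M₁ M₂ : ℕ} {U z z₁ z₂ : ℕ → ℕ} {S : Set ℕ}

/-- `z` distributes the entries of `U` inside `(l, r)` and one additional entry `M` over the
positions `l, …, r - 1`, within the bounds that come from the interval. At an apex `k` of a chord
`(a, b)` the chord bound is attained on `(a, k)` if `k ∈ S`, and on `(k, b)` otherwise. -/
structure IsFilling (U : ℕ → ℕ) (S : Set ℕ) (l r M : ℕ) (z : ℕ → ℕ) : Prop where
  total : block z l r = M ::ₘ block U (l + 1) r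
  lower : ∀ j, l ≤ j → j < r → Dominated (block U (l + 1) (j + 1)) (block z l j)
  upper : ∀ j, l < j → j ≤ r → Dominated (block z l j) (M ::ₘ block U (l + 1) j)
  left : ∀ a k b, IsApex U a k b → l ≤ a → b ≤ r → k ∈ S → block z a k = chordBlock U a k
  right : ∀ a k b, IsApex U a k b → l ≤ a → b ≤ r → k ∉ S → block z k b = chordBlock U k b

/-- The sequence that is `z₁` before the position `k`, and `z₂` from there on. -/
def glue (k : ℕ) (z₁ z₂ : ℕ → ℕ) (j : ℕ) : ℕ := if j < k then z₁ j else z₂ j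

theorem block_glue_of_le (hb : b ≤ k) : block (glue k z₁ z₂) a b = block z₁ a b :=
  block_congr fun _ _ hj => if_pos (hj.trans_le hb)

theorem block_glue_of_ge (ha : k ≤ a) : block (glue k z₁ z₂) a b = block z₂ a b :=
  block_congr fun _ hj _ => if_neg (ha.trans hj).not_gt

theorem block_glue (hak : a ≤ k) (hkb : k ≤ b) :
    block (glue k z₁ z₂) a b = block z₁ a k + block z₂ k b := by
  rw [← block_add_block _ hak hkb, block_glue_of_le le_rfl, block_glue_of_ge le_rfl]

namespace IsFilling

theorem singleton (U : ℕ → ℕ) (S : Set ℕ) (l M : ℕ) : IsFilling U S l (l + 1) M fun _ => M where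
  total := by rw [block_singleton, block_self, Multiset.cons_zero]
  lower j hj hj' := by
    obtain rfl : j = l := by omega
    rw [block_self, block_self]
    exact .refl 0
  upper j hj hj' := by
    obtain rfl : j = l + 1 := by omega
    rw [block_singleton, block_self, Multiset.cons_zero]
    exact .refl _
  left a k b hk ha hb := by have := hk.left_lt; have := hk.lt_right; omega
  right a k b hk ha hb := by have := hk.left_lt; have := hk.lt_right; omega

theorem glue_total (h₁ : IsFilling U S l k M₁ z₁) (h₂ : IsFilling U S k r M₂ z₂) (hlk : l < k)
    (hkr : k < r) (hM : M₁ = U k ∧ M₂ = M ∨ M₁ = M ∧ M₂ = U k) :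
    block (glue k z₁ z₂) l r = M ::ₘ block U (l + 1) r := by
  rw [block_glue hlk.le hkr.le, h₁.total, h₂.total,
    ← block_add_block U (Nat.add_one_le_of_lt hlk) hkr.le, block_succ_left U hkr,
    ← Multiset.singleton_add M₁, ← Multiset.singleton_add M₂, ← Multiset.singleton_add M,
    ← Multiset.singleton_add (U k)]
  rcases hM with ⟨rfl, rfl⟩ | ⟨rfl, rfl⟩ <;> abel

theorem glue_lower (h₁ : IsFilling U S l k M₁ z₁) (h₂ : IsFilling U S k r M₂ z₂) (hlk : l < k)
    (hM₁ : U k ≤ M₁) {j : ℕ} (hlj : l ≤ j) (hjr : j < r) :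
    Dominated (block U (l + 1) (j + 1)) (block (glue k z₁ z₂) l j) := by
  rcases lt_or_ge j k with hjk | hkj
  · rw [block_glue_of_le hjk.le]
    exact h₁.lower j hlj hjk
  · intro p
    have hright := h₂.lower j hkj hjr p
    rw [block_glue hlk.le hkj, h₁.total,
      ← block_add_block U (Nat.add_one_le_of_lt hlk) (by omega : k ≤ j + 1),
      block_succ_left U (by omega : k < j + 1)]
    simp only [countGE_add, countGE_cons]
    split_ifs <;> omega

theorem glue_upper (h₁ : IsFilling U S l k M₁ z₁) (h₂ : IsFilling U S k r M₂ z₂) (hlk : l < k)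
    (hM : M₁ = U k ∧ M₂ = M ∨ M₁ = M ∧ M₂ = U k) (hkM : U k ≤ M) {j : ℕ} (hlj : l < j)
    (hjr : j ≤ r) : Dominated (block (glue k z₁ z₂) l j) (M ::ₘ block U (l + 1) j) := by
  intro p
  rcases le_or_gt j k with hjk | hkj
  · have hleft := h₁.upper j hlj hjk p
    rw [block_glue_of_le hjk]
    simp only [countGE_cons] at hleft ⊢
    split_ifs at hleft ⊢ <;> omega
  · have hright := h₂.upper j hkj hjr p
    rw [block_glue hlk.le hkj.le, h₁.total,
      ← block_add_block U (Nat.add_one_le_of_lt hlk) hkj.le, block_succ_left U hkj]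
    simp only [countGE_add, countGE_cons] at hright ⊢
    rcases hM with ⟨rfl, rfl⟩ | ⟨rfl, rfl⟩ <;> omega

theorem glue_left (h₁ : IsFilling U S l k M₁ z₁) (h₂ : IsFilling U S k r M₂ z₂) (hlk : l < k)
    (hkr : k < r) (hmax : ∀ i, l < i → i < r → i ≠ k → U i < U k) (hM₁ : k ∈ S → M₁ = U k)
    {m : ℕ} (hm : IsApex U a m b) (ha : l ≤ a) (hb : b ≤ r) (hS : m ∈ S) :
    block (glue k z₁ z₂) a m = chordBlock U a m := by
  rcases hm.chord.eq_or_le_or_le ha hb hmax with ⟨rfl, rfl⟩ | hbk | hka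
  · obtain rfl := hm.eq_of_forall_lt hlk hkr hmax
    rw [block_glue_of_le le_rfl, h₁.total, hm.chordBlock_left, hM₁ hS]
  · rw [block_glue_of_le (hm.lt_right.le.trans hbk)]
    exact h₁.left a m b hm ha hbk hS
  · rw [block_glue_of_ge hka]
    exact h₂.left a m b hm hka hb hS

theorem glue_right (h₁ : IsFilling U S l k M₁ z₁) (h₂ : IsFilling U S k r M₂ z₂) (hlk : l < k)
    (hkr : k < r) (hmax : ∀ i, l < i → i < r → i ≠ k → U i < U k) (hM₂ : k ∉ S → M₂ = U k)
    {m : ℕ} (hm : IsApex U a m b) (ha : l ≤ a) (hb : b ≤ r) (hS : m ∉ S) :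
    block (glue k z₁ z₂) m b = chordBlock U m b := by
  rcases hm.chord.eq_or_le_or_le ha hb hmax with ⟨rfl, rfl⟩ | hbk | hka
  · obtain rfl := hm.eq_of_forall_lt hlk hkr hmax
    rw [block_glue_of_ge le_rfl, h₂.total, hm.chordBlock_right, hM₂ hS]
  · rw [block_glue_of_le hbk]
    exact h₁.right a m b hm ha hbk hS
  · rw [block_glue_of_ge (hka.trans hm.left_lt.le)]
    exact h₂.right a m b hm hka hb hS

theorem glue (h₁ : IsFilling U S l k M₁ z₁) (h₂ : IsFilling U S k r M₂ z₂) (hlk : l < k)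
    (hkr : k < r) (hmax : ∀ i, l < i → i < r → i ≠ k → U i < U k) (hkM : U k ≤ M)
    (hS : k ∈ S ∧ M₁ = U k ∧ M₂ = M ∨ k ∉ S ∧ M₁ = M ∧ M₂ = U k) :
    IsFilling U S l r M (glue k z₁ z₂) where
  total := h₁.glue_total h₂ hlk hkr (hS.imp And.right And.right)
  lower _ := h₁.glue_lower h₂ hlk (by omega)
  upper _ := h₁.glue_upper h₂ hlk (hS.imp And.right And.right) hkM
  left _ _ _ := h₁.glue_left h₂ hlk hkr hmax (by tauto)
  right _ _ _ := h₁.glue_right h₂ hlk hkr hmax (by tauto)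

end IsFilling

/-- Recursively at the largest entry `U k` inside `(l, r)`: either `U k` stays to the left of the
position `k` and `M` moves to its right, or the other way around. -/
theorem exists_isFilling (U : ℕ → ℕ) (S : Set ℕ) (hlr : l < r)
    (hM : ∀ i, l < i → i < r → U i ≤ M) (hinj : Set.InjOn U (Set.Ioo l r)) :
    ∃ z, IsFilling U S l r M z := by
  induction hd : r - l using Nat.strong_induction_on generalizing l r M with
  | _ d ih =>
    rcases (Nat.add_one_le_of_lt hlr).lt_or_eq with hlt | rfl
    · obtain ⟨k, hlk, hkr, hmax⟩ := exists_forall_lt_of_injOn hlt hinj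
      have hUk : ∀ i, l < i → i < r → U i ≤ U k := fun i hi hi' =>
        (eq_or_ne i k).elim (fun h => h ▸ le_rfl) fun h => (hmax i hi hi' h).le
      have hleft : ∀ M', U k ≤ M' → ∃ z, IsFilling U S l k M' z := fun M' hM' =>
        ih (k - l) (by omega) hlk (fun i hi hi' => (hUk i hi (hi'.trans hkr)).trans hM')
          (hinj.mono (Set.Ioo_subset_Ioo_right hkr.le)) rfl
      have hright : ∀ M', U k ≤ M' → ∃ z, IsFilling U S k r M' z := fun M' hM' =>
        ih (r - k) (by omega) hkr (fun i hi hi' => (hUk i (hlk.trans hi) hi').trans hM')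
          (hinj.mono (Set.Ioo_subset_Ioo_left hlk.le)) rfl
      have hkM := hM k hlk hkr
      by_cases hS : k ∈ S
      · obtain ⟨z₁, h₁⟩ := hleft _ le_rfl
        obtain ⟨z₂, h₂⟩ := hright _ hkM
        exact ⟨_, h₁.glue h₂ hlk hkr hmax hkM (Or.inl ⟨hS, rfl, rfl⟩)⟩
      · obtain ⟨z₁, h₁⟩ := hleft _ hkM
        obtain ⟨z₂, h₂⟩ := hright _ le_rfl
        exact ⟨_, h₁.glue h₂ hlk hkr hmax hkM (Or.inr ⟨hS, rfl, rfl⟩)⟩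
    · exact ⟨_, .singleton U S l M⟩

theorem exists_perm_of_block_eq (v : Equiv.Perm (Fin (n + 1)))
    (h : block z 0 (n + 1) = block (oneLine v) 0 (n + 1)) :
    ∃ w : Equiv.Perm (Fin (n + 1)), ∀ j < n + 1, oneLine w j = z j := by
  have hlt : ∀ j < n + 1, z j < n + 1 := by
    intro j hj
    have hmem : z j ∈ block (oneLine v) 0 (n + 1) := h ▸ mem_block.2 ⟨j, ⟨Nat.zero_le j, hj⟩, rfl⟩
    obtain ⟨i, ⟨-, hi⟩, hij⟩ := mem_block.1 hmem
    rw [← hij, oneLine_of_lt v hi]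
    exact Fin.is_lt _
  have hsurj : Function.Surjective fun j : Fin (n + 1) => (⟨z j, hlt j j.2⟩ : Fin (n + 1)) := by
    intro p
    have hmem : (p : ℕ) ∈ block z 0 (n + 1) := by
      rw [h, mem_block]
      refine ⟨v.symm p, ⟨Nat.zero_le _, Fin.is_lt _⟩, ?_⟩
      rw [oneLine_of_lt v (Fin.is_lt _), Fin.eta, Equiv.apply_symm_apply]
    obtain ⟨j, ⟨-, hj⟩, hjp⟩ := mem_block.1 hmem
    exact ⟨⟨j, hj⟩, Fin.ext hjp⟩
  exact ⟨Equiv.ofBijective _ (Finite.surjective_iff_bijective.1 hsurj),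
    fun j hj => oneLine_of_lt _ hj⟩

theorem IsFilling.segmentBounds (h : IsFilling U S 0 (n + 1) (U 0) z) (hU : U (n + 1) = U 0) :
    SegmentBounds n U z := by
  intro k hk
  rcases Nat.eq_zero_or_pos k with rfl | hk₀
  · simp only [zero_add, block_self]
    exact ⟨.refl 0, .refl 0⟩
  · rw [block_succ_left U hk₀]
    refine ⟨?_, h.upper k hk₀ hk⟩
    rcases hk.lt_or_eq with hkn | rfl
    · exact h.lower k (Nat.zero_le k) hkn
    · rw [h.total, block_succ_right U (Nat.succ_pos n), hU]
      exact .refl _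

theorem exists_mem_interval_of_set (u : Equiv.Perm (Fin n)) (S : Set ℕ) :
    ∃ z : Equiv.Perm (Fin (n + 1)), SegmentBounds n (paddedSeq u) (oneLine z) ∧
      ∀ a k b, IsApex (paddedSeq u) a k b → b ≤ n + 1 →
        (k ∈ S → block (oneLine z) a k = chordBlock (paddedSeq u) a k) ∧
        (k ∉ S → block (oneLine z) k b = chordBlock (paddedSeq u) k b) := by
  obtain ⟨z, hz⟩ := exists_isFilling (paddedSeq u) S (Nat.succ_pos n)
    (fun i _ _ => (paddedSeq_le u i).trans_eq (paddedSeq_zero u).symm) (injOn_paddedSeq u)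
  obtain ⟨w, hw⟩ := exists_perm_of_block_eq (z := z) (addTail u * sDown n) <| by
    rw [hz.total, ← block_succ_left _ (Nat.succ_pos n)]
    exact block_congr fun j _ hj => (oneLine_addTail_mul_sDown u hj).symm
  have hwz : ∀ {a b}, b ≤ n + 1 → block (oneLine w) a b = block z a b := fun hb =>
    block_congr fun j _ hj => hw j (hj.trans_le hb)
  refine ⟨w, fun k hk => ?_, fun a k b hk hb => ⟨fun hS => ?_, fun hS => ?_⟩⟩
  · rw [hwz hk]
    exact hz.segmentBounds ((paddedSeq_last u).trans (paddedSeq_zero u).symm) k hk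
  · rw [hwz (hk.lt_right.le.trans hb)]
    exact hz.left a k b hk (Nat.zero_le a) hb hS
  · rw [hwz hb]
    exact hz.right a k b hk (Nat.zero_le a) hb hS

end Filling

/-! ### Polytopes with a crosspolytopal normal fan -/

section CrosspolytopalFan

variable {ι κ V W : Type*} [AddCommGroup V] [Module ℝ V] [AddCommGroup W] [Module ℝ W]

/-- The set of the cones that are spanned by vectors `g i`, at most one from each pair
`g (k, false)`, `g (k, true)`. For linearly independent choices it is the face fan of a simplicial
polytope of the combinatorial type of a crosspolytope. -/
def crosspolytopalFan (g : ι × Bool → V) : Set (PointedCone ℝ V) :=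
  {σ | ∃ Q ⊆ Set.range g, (∀ k, ¬ ∀ ε, g (k, ε) ∈ Q) ∧ σ = PointedCone.hull ℝ Q}

theorem crosspolytopalFan_comp_map (g : κ × Bool → V) {f : ι → κ} (hf : Function.Surjective f) :
    crosspolytopalFan (g ∘ Prod.map f id) = crosspolytopalFan g := by
  have hrange : Set.range (g ∘ Prod.map f id) = Set.range g :=
    (hf.prodMap Function.surjective_id).range_comp g
  simp only [crosspolytopalFan, hrange, hf.forall]
  rfl

theorem map_mem_crosspolytopalFan (Φ : V ≃ₗ[ℝ] W) {g : ι × Bool → V} {σ : PointedCone ℝ V}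
    (hσ : σ ∈ crosspolytopalFan g) :
    PointedCone.map (Φ : V →ₗ[ℝ] W) σ ∈ crosspolytopalFan (Φ ∘ g) := by
  obtain ⟨Q, hQ, hpair, rfl⟩ := hσ
  refine ⟨Φ '' Q, ?_, fun k hk => hpair k fun ε => ?_, (Submodule.map_span _ Q)⟩
  · rw [Set.range_comp]
    exact Set.image_mono hQ
  · exact Φ.injective.mem_set_image.1 (hk ε)

theorem bijOn_crosspolytopalFan (Φ : V ≃ₗ[ℝ] W) (g : ι × Bool → V) :
    Set.BijOn (PointedCone.map (Φ : V →ₗ[ℝ] W)) (crosspolytopalFan g)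
      (crosspolytopalFan (Φ ∘ g)) := by
  have hinv : ∀ σ, PointedCone.map (Φ.symm : W →ₗ[ℝ] V) (PointedCone.map (Φ : V →ₗ[ℝ] W) σ) = σ :=
    fun σ => by rw [PointedCone.map_map, LinearEquiv.symm_comp, PointedCone.map_id]
  have hinv' : ∀ σ, PointedCone.map (Φ : V →ₗ[ℝ] W) (PointedCone.map (Φ.symm : W →ₗ[ℝ] V) σ) = σ :=
    fun σ => by rw [PointedCone.map_map, LinearEquiv.comp_symm, PointedCone.map_id]
  refine Set.InvOn.bijOn ⟨fun σ _ => hinv σ, fun σ _ => hinv' σ⟩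
    (fun σ => map_mem_crosspolytopalFan Φ) fun σ hσ => ?_
  have hg : Φ.symm ∘ (Φ ∘ g) = g := by
    funext i
    exact Φ.symm_apply_apply (g i)
  exact hg ▸ map_mem_crosspolytopalFan Φ.symm hσ

end CrosspolytopalFan

section NormalCone

variable {n : ℕ} {P F : Set (Fin (n + 1) → ℝ)}

theorem dotProduct_sub_eq_of_mkQ_eq {y y' p q : Fin (n + 1) → ℝ}
    (h : (diagonalLine n).mkQ y = (diagonalLine n).mkQ y') (hpq : ∑ i, p i = ∑ i, q i) :
    y ⬝ᵥ p - y ⬝ᵥ q = y' ⬝ᵥ p - y' ⬝ᵥ q := by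
  rw [Submodule.mkQ_apply, Submodule.mkQ_apply, Submodule.Quotient.eq, diagonalLine,
    Submodule.mem_span_singleton] at h
  obtain ⟨c, hc⟩ := h
  have hy : y = y' + c • 1 := sub_eq_iff_eq_add'.1 hc.symm
  rw [hy, add_dotProduct, add_dotProduct, smul_dotProduct, smul_dotProduct, one_dotProduct,
    one_dotProduct, hpq]
  ring

theorem mem_normalCone {x : NReal n} :
    x ∈ normalCone P F ↔
      ∃ y, (∀ p ∈ P, ∀ f ∈ F, y ⬝ᵥ f ≤ y ⬝ᵥ p) ∧ (diagonalLine n).mkQ y = x := by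
  rw [normalCone, PointedCone.mem_map]
  refine exists_congr fun y => and_congr_left fun _ => ?_
  rw [PointedCone.mem_dual]
  simp only [Set.mem_sub, forall_exists_index, and_imp, dotProductBilin_apply_apply]
  constructor
  · intro h p hp f hf
    have hpf := h p hp f hf rfl
    rwa [dotProduct_comm, dotProduct_sub, sub_nonneg] at hpf
  · rintro h _ p hp f hf rfl
    rw [dotProduct_comm, dotProduct_sub, sub_nonneg]
    exact h p hp f hf

theorem exists_eq_minimizers_of_isExposed (hF : F.Nonempty) (hexp : IsExposed ℝ P F) :
    ∃ y, F = {p ∈ P | ∀ q ∈ P, y ⬝ᵥ p ≤ y ⬝ᵥ q} := by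
  obtain ⟨l, rfl⟩ := hexp hF
  obtain ⟨y, hy⟩ : ∃ y, ∀ p, y ⬝ᵥ p = -l p :=
    ⟨fun i => -l (Pi.single i 1), fun p => by
      conv_rhs => rw [pi_eq_sum_univ' p]
      rw [map_sum, ← Finset.sum_neg_distrib]
      exact Finset.sum_congr rfl fun i _ => by rw [map_smul, smul_eq_mul, neg_mul, mul_comm]⟩
  exact ⟨y, by simp only [hy, neg_le_neg_iff]⟩

theorem isExposed_minimizers (P : Set (Fin (n + 1) → ℝ)) (y : Fin (n + 1) → ℝ) :
    IsExposed ℝ P {p ∈ P | ∀ q ∈ P, y ⬝ᵥ p ≤ y ⬝ᵥ q} := fun _ =>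
  ⟨LinearMap.toContinuousLinearMap (-(dotProductBilin ℝ ℝ y)), by simp⟩

end NormalCone

section IsCubical

variable {n : ℕ} {ι : Type*} {P : Set (Fin (n + 1) → ℝ)} {a : ι × Bool → Fin (n + 1) → ℝ}
  {A : ι × Bool → ℝ} {S : Set (ι × Bool)}

/-- The polytope `P`, of constant coordinate sum, has the combinatorics of a cube: it satisfies
the inequalities `A i ≤ a i ⬝ᵥ p`, which come in pairs `(k, false)`, `(k, true)` like the opposite
facets of a cube, and the vertices are given by arbitrary choices of one facet from each pair. The
completeness of the normal fan is a part of the definition. -/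
structure IsCubical [Fintype ι] (P : Set (Fin (n + 1) → ℝ)) (a : ι × Bool → Fin (n + 1) → ℝ)
    (A : ι × Bool → ℝ) : Prop where
  le_dotProduct : ∀ p ∈ P, ∀ i, A i ≤ a i ⬝ᵥ p
  not_both : ∀ p ∈ P, ∀ k, ¬ ∀ ε, a (k, ε) ⬝ᵥ p = A (k, ε)
  exists_vertex : ∀ ε : ι → Bool, ∃ p ∈ P, ∀ k, a (k, ε k) ⬝ᵥ p = A (k, ε k)
  sum_eq : ∀ p ∈ P, ∀ q ∈ P, ∑ i, p i = ∑ i, q i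
  exists_eq_sum : ∀ x : NReal n, ∃ (ε : ι → Bool) (γ : ι → ℝ), (∀ k, 0 ≤ γ k) ∧
    x = ∑ k, γ k • (diagonalLine n).mkQ (a (k, ε k))

theorem exists_choice_of_injOn (hS : Set.InjOn Prod.fst S) :
    ∃ ε : ι → Bool, ∀ i ∈ S, ε i.1 = i.2 := by
  classical
  refine ⟨fun k => decide ((k, true) ∈ S), ?_⟩
  rintro ⟨k, _ | _⟩ hi
  · exact decide_eq_false fun hk => Bool.false_ne_true (congrArg Prod.snd (hS hi hk rfl))
  · exact decide_eq_true hi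

namespace IsCubical

/-- The face of `P` on which the inequalities with an index in `S` are equalities. -/
def face (P : Set (Fin (n + 1) → ℝ)) (a : ι × Bool → Fin (n + 1) → ℝ) (A : ι × Bool → ℝ)
    (S : Set (ι × Bool)) : Set (Fin (n + 1) → ℝ) :=
  {p ∈ P | ∀ i ∈ S, a i ⬝ᵥ p = A i}

variable [Fintype ι]

theorem face_nonempty (h : IsCubical P a A) (hS : Set.InjOn Prod.fst S) :
    (face P a A S).Nonempty := by
  obtain ⟨ε, hε⟩ := exists_choice_of_injOn hS
  obtain ⟨p, hp, heq⟩ := h.exists_vertex ε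
  exact ⟨p, hp, fun i hi => by simpa only [hε i hi] using heq i.1⟩

theorem minimizers_eq_face (h : IsCubical P a A) {ε : ι → Bool} {γ : ι → ℝ} (hγ : ∀ k, 0 ≤ γ k)
    {y : Fin (n + 1) → ℝ}
    (hy : (diagonalLine n).mkQ y = ∑ k, γ k • (diagonalLine n).mkQ (a (k, ε k))) :
    {p ∈ P | ∀ q ∈ P, y ⬝ᵥ p ≤ y ⬝ᵥ q} = face P a A ((fun k => (k, ε k)) '' {k | 0 < γ k}) := by
  obtain ⟨v, hv, heq⟩ := h.exists_vertex ε
  have hsub : ∀ p ∈ P, y ⬝ᵥ p - y ⬝ᵥ v = ∑ k, γ k * (a (k, ε k) ⬝ᵥ p - A (k, ε k)) := by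
    intro p hp
    have hy' : (diagonalLine n).mkQ y = (diagonalLine n).mkQ (∑ k, γ k • a (k, ε k)) := by
      simp only [map_sum, map_smul, hy]
    rw [dotProduct_sub_eq_of_mkQ_eq hy' (h.sum_eq p hp v hv), sum_dotProduct, sum_dotProduct,
      ← Finset.sum_sub_distrib]
    simp only [smul_dotProduct, smul_eq_mul, heq, mul_sub]
  have hterm : ∀ p ∈ P, ∀ k, 0 ≤ γ k * (a (k, ε k) ⬝ᵥ p - A (k, ε k)) := fun p hp k =>
    mul_nonneg (hγ k) (sub_nonneg.2 (h.le_dotProduct p hp _))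
  have hmin : ∀ p ∈ P, y ⬝ᵥ v ≤ y ⬝ᵥ p := fun p hp =>
    sub_nonneg.1 ((hsub p hp).symm ▸ Finset.sum_nonneg fun k _ => hterm p hp k)
  ext p
  refine and_congr_right fun hp => ?_
  calc (∀ q ∈ P, y ⬝ᵥ p ≤ y ⬝ᵥ q) ↔ y ⬝ᵥ p - y ⬝ᵥ v = 0 :=
        ⟨fun hle => sub_eq_zero.2 ((hle v hv).antisymm (hmin p hp)),
          fun h0 q hq => (sub_eq_zero.1 h0).trans_le (hmin q hq)⟩
    _ ↔ ∀ k, γ k * (a (k, ε k) ⬝ᵥ p - A (k, ε k)) = 0 := by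
        rw [hsub p hp, Finset.sum_eq_zero_iff_of_nonneg fun k _ => hterm p hp k]
        simp only [Finset.mem_univ, true_imp_iff]
    _ ↔ ∀ i ∈ (fun k => (k, ε k)) '' {k | 0 < γ k}, a i ⬝ᵥ p = A i := by
        simp only [Set.forall_mem_image, mul_eq_zero, sub_eq_zero, Set.mem_ofPred_eq,
          (hγ _).lt_iff_ne', or_iff_not_imp_left, ne_eq]

theorem isExposed_face (h : IsCubical P a A) (hS : Set.InjOn Prod.fst S) :
    IsExposed ℝ P (face P a A S) := by
  classical
  obtain ⟨ε, hε⟩ := exists_choice_of_injOn hS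
  set γ : ι → ℝ := fun k => if (k, ε k) ∈ S then 1 else 0
  have hpos : ∀ k, 0 < γ k ↔ (k, ε k) ∈ S := fun k => by
    dsimp only [γ]
    split_ifs with hk <;> simp [hk]
  have hface : (fun k => (k, ε k)) '' {k | 0 < γ k} = S := by
    ext i
    constructor
    · rintro ⟨k, hk, rfl⟩
      exact (hpos k).1 hk
    · exact fun hi => ⟨i.1, (hpos _).2 (by rwa [hε i hi]), Prod.ext rfl (hε i hi)⟩
  rw [← hface, ← h.minimizers_eq_face (fun k => by positivity)
    (y := ∑ k, γ k • a (k, ε k)) (by simp only [map_sum, map_smul])]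
  exact isExposed_minimizers P _

theorem mem_of_face_subset (h : IsCubical P a A) (hS : Set.InjOn Prod.fst S) {i : ι × Bool}
    (hi : ∀ p ∈ face P a A S, a i ⬝ᵥ p = A i) : i ∈ S := by
  by_contra hiS
  obtain ⟨k, e⟩ := i
  have hopp : ∀ e', (k, e') ∈ S → e' = !e := fun e' he' =>
    Bool.eq_not.2 fun heq => hiS (heq ▸ he')
  have hinj : Set.InjOn Prod.fst (insert (k, !e) S) := by
    rintro ⟨j, c⟩ (hj | hj) ⟨j', c'⟩ (hj' | hj') hjj'
    · exact hj.trans hj'.symm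
    · obtain ⟨rfl, rfl⟩ := Prod.mk.inj hj
      obtain rfl : j = j' := hjj'
      rw [hopp c' hj']
    · obtain ⟨rfl, rfl⟩ := Prod.mk.inj hj'
      obtain rfl : j = j' := hjj'
      rw [hopp c hj]
    · exact hS hj hj' hjj'
  obtain ⟨p, hp, heq⟩ := h.face_nonempty hinj
  have hpe := hi p ⟨hp, fun i hi => heq i (Set.mem_insert_of_mem _ hi)⟩
  have hpe' := heq _ (Set.mem_insert _ _)
  exact h.not_both p hp k (by cases e <;> exact Bool.forall_bool.2 ⟨‹_›, ‹_›⟩)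

theorem normalCone_face (h : IsCubical P a A) (hS : Set.InjOn Prod.fst S) :
    normalCone P (face P a A S) =
      PointedCone.hull ℝ ((fun i => (diagonalLine n).mkQ (a i)) '' S) := by
  apply le_antisymm
  · intro x hx
    obtain ⟨y, hy, rfl⟩ := mem_normalCone.1 hx
    obtain ⟨ε, γ, hγ, hsum⟩ := h.exists_eq_sum ((diagonalLine n).mkQ y)
    have hsub : face P a A S ⊆ face P a A ((fun k => (k, ε k)) '' {k | 0 < γ k}) := by
      rw [← h.minimizers_eq_face hγ hsum]
      exact fun p hp => ⟨hp.1, fun q hq => hy q hq p hp⟩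
    rw [hsum]
    refine Submodule.sum_mem _ fun k _ => ?_
    rcases (hγ k).eq_or_lt with h0 | hpos
    · rw [← h0, zero_smul]
      exact Submodule.zero_mem _
    · have hk : (k, ε k) ∈ S :=
        h.mem_of_face_subset hS fun p hp => (hsub hp).2 _ (Set.mem_image_of_mem _ hpos)
      exact PointedCone.smul_mem _ (hγ k) (PointedCone.subset_hull (Set.mem_image_of_mem _ hk))
  · refine Submodule.span_le.2 (Set.forall_mem_image.2 fun i hi => ?_)
    exact mem_normalCone.2
      ⟨a i, fun p hp f hf => (hf.2 i hi).trans_le (h.le_dotProduct p hp i), rfl⟩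

theorem dotProduct_eq_of_mkQ_mem (h : IsCubical P a A) {i : ι × Bool} {f : Fin (n + 1) → ℝ}
    (hf : f ∈ face P a A S)
    (hi : (diagonalLine n).mkQ (a i) ∈ (fun i => (diagonalLine n).mkQ (a i)) '' S) :
    a i ⬝ᵥ f = A i := by
  obtain ⟨j, hj, hij⟩ := hi
  obtain ⟨p, hp, heq⟩ := h.exists_vertex fun _ => i.2
  have hsub := dotProduct_sub_eq_of_mkQ_eq hij (h.sum_eq p hp f hf.1)
  have hpi : a i ⬝ᵥ p = A i := heq i.1
  have hjp := h.le_dotProduct p hp j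
  have hjf := hf.2 j hj
  exact (by linarith : a i ⬝ᵥ f ≤ A i).antisymm (h.le_dotProduct f hf.1 i)

theorem normalFan_eq (h : IsCubical P a A) :
    normalFan P = crosspolytopalFan fun i => (diagonalLine n).mkQ (a i) := by
  ext σ
  constructor
  · rintro ⟨F, hF, hexp, rfl⟩
    obtain ⟨y, rfl⟩ := exists_eq_minimizers_of_isExposed hF hexp
    obtain ⟨ε, γ, hγ, hsum⟩ := h.exists_eq_sum ((diagonalLine n).mkQ y)
    rw [h.minimizers_eq_face hγ hsum] at hF ⊢
    have hinj : Set.InjOn Prod.fst ((fun k => (k, ε k)) '' {k | 0 < γ k}) := by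
      rintro _ ⟨k, -, rfl⟩ _ ⟨k', -, rfl⟩ (rfl : k = k')
      rfl
    obtain ⟨f, hf⟩ := hF
    exact ⟨_, Set.image_subset_range _ _,
      fun k hk => h.not_both f hf.1 k fun ε => h.dotProduct_eq_of_mkQ_mem hf (hk ε),
      h.normalCone_face hinj⟩
  · rintro ⟨Q, hQ, hpair, rfl⟩
    set S := (fun i => (diagonalLine n).mkQ (a i)) ⁻¹' Q
    have hinj : Set.InjOn Prod.fst S := by
      rintro ⟨k, e⟩ he ⟨_, e'⟩ he' rfl
      by_contra hne
      refine hpair k fun ε => ?_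
      cases e <;> cases e' <;> cases ε <;> first | assumption | exact absurd rfl hne
    refine ⟨_, h.face_nonempty hinj, h.isExposed_face hinj, ?_⟩
    rw [h.normalCone_face hinj, Set.image_preimage_eq_of_subset hQ]

end IsCubical

end IsCubical

/-! ### The polytope of the interval -/

section TriangularPairs

variable {ι V : Type*} [AddCommGroup V] [Module ℝ V]

theorem exists_sub_smul_mem {W : Submodule ℝ V} {g : Bool → V} {e y : V} (htrue : e - g true ∈ W)
    (hfalse : e + g false ∈ W) (c : ℝ) (hy : y ∈ W) :
    ∃ (b : Bool) (d : ℝ), 0 ≤ d ∧ c • e + y - d • g b ∈ W := by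
  rcases le_total 0 c with hc | hc
  · refine ⟨true, c, hc, ?_⟩
    convert add_mem (W.smul_mem c htrue) hy using 1
    module
  · refine ⟨false, -c, neg_nonneg.2 hc, ?_⟩
    convert add_mem (W.smul_mem c hfalse) hy using 1
    module

/-- Removing the index with the smallest value of `U` first, the sign of the coefficient of `e k`
decides which of the two vectors with the index `k` is used. -/
theorem exists_eq_sum_of_triangular {g : ι × Bool → V} {e : ι → V} {U : ι → ℕ} (s : Finset ι)
    (htrue : ∀ k ∈ s, e k - g (k, true) ∈ Submodule.span ℝ (e '' {j | j ∈ s ∧ U k < U j}))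
    (hfalse : ∀ k ∈ s, e k + g (k, false) ∈ Submodule.span ℝ (e '' {j | j ∈ s ∧ U k < U j}))
    {x : V} (hx : x ∈ Submodule.span ℝ (e '' s)) :
    ∃ (ε : ι → Bool) (γ : ι → ℝ), (∀ k, 0 ≤ γ k) ∧ x = ∑ k ∈ s, γ k • g (k, ε k) := by
  classical
  induction s using Finset.induction_on_min_value U generalizing x with
  | empty =>
    rw [Finset.coe_empty, Set.image_empty, Submodule.span_empty, Submodule.mem_bot] at hx
    exact ⟨fun _ => true, 0, fun _ => le_rfl, by simp [hx]⟩
  | insert k s hks hmin ih =>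
    have habove : ∀ i ∈ insert k s, {j | j ∈ insert k s ∧ U i < U j} = {j | j ∈ s ∧ U i < U j} := by
      intro i hi
      have hki : U k ≤ U i := (Finset.mem_insert.1 hi).elim (fun h => h ▸ le_rfl) (hmin i)
      ext j
      rw [Set.mem_ofPred_eq, Set.mem_ofPred_eq, Finset.mem_insert]
      exact ⟨fun h => ⟨h.1.resolve_left (by rintro rfl; exact hki.not_gt h.2), h.2⟩,
        fun h => ⟨Or.inr h.1, h.2⟩⟩
    have hspan : Submodule.span ℝ (e '' {j | j ∈ s ∧ U k < U j}) ≤ Submodule.span ℝ (e '' s) :=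
      Submodule.span_mono (Set.image_mono fun j hj => hj.1)
    have hk := Finset.mem_insert_self k s
    rw [Finset.coe_insert, Set.image_insert_eq, Submodule.mem_span_insert] at hx
    obtain ⟨c, y, hy, rfl⟩ := hx
    obtain ⟨b, d, hd, hmem⟩ := exists_sub_smul_mem (g := fun b => g (k, b))
      (hspan (habove k hk ▸ htrue k hk)) (hspan (habove k hk ▸ hfalse k hk)) c hy
    obtain ⟨ε, γ, hγ, hsum⟩ := ih
      (fun i hi => habove i (Finset.mem_insert_of_mem hi) ▸ htrue i (Finset.mem_insert_of_mem hi))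
      (fun i hi => habove i (Finset.mem_insert_of_mem hi) ▸ hfalse i (Finset.mem_insert_of_mem hi))
      hmem
    refine ⟨Function.update ε k b, Function.update γ k d, fun j => ?_, ?_⟩
    · rcases eq_or_ne j k with rfl | hjk
      · rwa [Function.update_self]
      · rw [Function.update_of_ne hjk]
        exact hγ j
    · rw [Finset.sum_insert hks, Function.update_self, Function.update_self, ← sub_eq_iff_eq_add',
        hsum]
      refine Finset.sum_congr rfl fun j hj => ?_
      have hjk : j ≠ k := ne_of_mem_of_not_mem hj hks
      rw [Function.update_of_ne hjk, Function.update_of_ne hjk]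

end TriangularPairs

section InitVec

variable {n : ℕ}

/-- The vector `e_1 + ⋯ + e_i`, which represents `ϖ_i`. -/
def initVec (n i : ℕ) : Fin (n + 1) → ℝ := fun j => if (j : ℕ) < i then 1 else 0

theorem mkQ_initVec (n i : ℕ) : (diagonalLine n).mkQ (initVec n i) = varpi n i := rfl

theorem initVec_succ (j : Fin (n + 1)) : initVec n (j + 1) = initVec n j + Pi.single j 1 := by
  ext i
  rcases lt_trichotomy i j with h | rfl | h
  · simp [initVec, h, h.ne, Nat.lt_succ_of_lt (Fin.lt_def.1 h)]
  · simp [initVec]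
  · simp [initVec, h.ne', Nat.not_lt.2 h.le, h]

theorem varpi_eq_zero {i : ℕ} (hi : i ∉ Finset.Icc 1 n) : varpi n i = 0 := by
  rw [← mkQ_initVec, Submodule.mkQ_apply, Submodule.Quotient.mk_eq_zero, diagonalLine]
  rw [Finset.mem_Icc] at hi
  rcases Nat.eq_zero_or_pos i with rfl | hpos
  · convert Submodule.zero_mem _
    ext j
    simp [initVec]
  · convert Submodule.mem_span_singleton_self _
    exact if_pos (by omega)

theorem varpi_mem_span {i : ℕ} {s : Set (Finset.Icc 1 n)}
    (hi : ∀ h, (⟨i, h⟩ : Finset.Icc 1 n) ∈ s) :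
    varpi n i ∈ Submodule.span ℝ ((fun k : Finset.Icc 1 n => varpi n k) '' s) := by
  by_cases h : i ∈ Finset.Icc 1 n
  · exact Submodule.subset_span ⟨_, hi h, rfl⟩
  · exact varpi_eq_zero h ▸ Submodule.zero_mem _

theorem mem_span_varpi (x : NReal n) :
    x ∈ Submodule.span ℝ ((fun k : Finset.Icc 1 n => varpi n k) '' Set.univ) := by
  obtain ⟨y, rfl⟩ := (diagonalLine n).mkQ_surjective x
  rw [pi_eq_sum_univ' y, map_sum]
  refine Submodule.sum_mem _ fun j _ => ?_
  rw [map_smul, ← sub_eq_iff_eq_add'.2 (initVec_succ j), map_sub, mkQ_initVec, mkQ_initVec]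
  exact Submodule.smul_mem _ _ (sub_mem (varpi_mem_span fun _ => Set.mem_univ _)
    (varpi_mem_span fun _ => Set.mem_univ _))

theorem initVec_sub_dotProduct_permPoint (z : Equiv.Perm (Fin (n + 1))) {a b : ℕ} (hab : a ≤ b)
    (hb : b ≤ n + 1) :
    (initVec n b - initVec n a) ⬝ᵥ permPoint z =
      (((block (oneLine z) a b).sum + (b - a) : ℕ) : ℝ) := by
  induction b, hab using Nat.le_induction with
  | base => simp [block_self]
  | succ b hab ih =>
    have hsucc := initVec_succ (⟨b, hb⟩ : Fin (n + 1))
    rw [Fin.val_mk] at hsucc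
    rw [hsucc, add_sub_right_comm, add_dotProduct, ih (by omega), single_dotProduct, one_mul,
      block_succ_right _ hab, Multiset.sum_cons, oneLine_of_lt z hb, permPoint, ← Nat.cast_succ,
      ← Nat.cast_add]
    congr 1
    omega

end InitVec

section IntervalPolytope

variable {n : ℕ} {u : Equiv.Perm (Fin n)} {a b : Finset.Icc 1 n → ℕ}

theorem le_dotProduct_of_mem_convexHull {s : Set (Fin (n + 1) → ℝ)} {y p : Fin (n + 1) → ℝ}
    {c : ℝ} (h : ∀ q ∈ s, c ≤ y ⬝ᵥ q) (hp : p ∈ convexHull ℝ s) : c ≤ y ⬝ᵥ p :=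
  convexHull_min h (convex_halfSpace_ge (dotProductBilin ℝ ℝ y).isLinear c) hp

theorem sum_eq_of_mem_bruhatIntervalPolytope {v w : Equiv.Perm (Fin (n + 1))}
    {p : Fin (n + 1) → ℝ} (hp : p ∈ bruhatIntervalPolytope v w) :
    ∑ i, p i = ∑ i : Fin (n + 1), (((i : ℕ) : ℝ) + 1) := by
  have hc : Convex ℝ {p : Fin (n + 1) → ℝ | ∑ i, p i = ∑ i : Fin (n + 1), (((i : ℕ) : ℝ) + 1)} :=
    convex_hyperplane ⟨fun p q => by simp [Finset.sum_add_distrib],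
      fun c p => by simp [Finset.mul_sum]⟩ _
  refine convexHull_min ?_ hc hp
  rintro _ ⟨z, -, rfl⟩
  exact Equiv.sum_comp z fun i : Fin (n + 1) => ((i : ℕ) : ℝ) + 1

/-- The right hand side of the facet inequality that belongs to the chord `(a, b)` of `U`. The
number `b - a` accounts for the entries of `oneLine` being smaller by `1` than those of
`permPoint`. -/
def chordBound (U : ℕ → ℕ) (a b : ℕ) : ℝ := ((chordBlock U a b).sum + (b - a) : ℕ)

theorem chordBound_le_dotProduct {x y : ℕ} (hxy : IsChord (paddedSeq u) x y) (hy : y ≤ n + 1)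
    {p : Fin (n + 1) → ℝ}
    (hp : p ∈ bruhatIntervalPolytope (addTail u) (addTail u * sDown n)) :
    chordBound (paddedSeq u) x y ≤ (initVec n y - initVec n x) ⬝ᵥ p := by
  refine le_dotProduct_of_mem_convexHull ?_ hp
  rintro _ ⟨z, hz, rfl⟩
  rw [initVec_sub_dotProduct_permPoint z hxy.1.le hy, chordBound, Nat.cast_le]
  have hdom := ((mem_interval_iff u z).1 hz).dominated_chordBlock
    (fun j => (paddedSeq_le u j).trans_eq (paddedSeq_zero u).symm) hxy hy
  exact Nat.add_le_add_right hdom.sum_le _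

theorem IsApex.chordBound_add_lt {U : ℕ → ℕ} {x k y : ℕ} (h : IsApex U x k y) :
    chordBound U x k + chordBound U k y < chordBound U x y := by
  have hsum := h.sum_chordBlock_lt
  have hxk := h.left_lt
  have hky := h.lt_right
  rw [chordBound, chordBound, chordBound, ← Nat.cast_add, Nat.cast_lt]
  omega

/-- The edges `(a k, k)`, with the second index `true`, and `(k, b k)`. -/
def apexEdge (a b : Finset.Icc 1 n → ℕ) : Finset.Icc 1 n × Bool → ℕ × ℕ
  | (k, true) => (a k, k)
  | (k, false) => (k, b k)

theorem isChord_apexEdge (h : ∀ k, IsApex (paddedSeq u) (a k) k (b k) ∧ b k ≤ n + 1)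
    (i : Finset.Icc 1 n × Bool) :
    IsChord (paddedSeq u) (apexEdge a b i).1 (apexEdge a b i).2 ∧ (apexEdge a b i).2 ≤ n + 1 := by
  obtain ⟨k, _ | _⟩ := i
  · exact ⟨(h k).1.chord_right, (h k).2⟩
  · exact ⟨(h k).1.chord_left, (h k).1.lt_right.le.trans (h k).2⟩

theorem exists_vertex_of_choice (h : ∀ k, IsApex (paddedSeq u) (a k) k (b k) ∧ b k ≤ n + 1)
    (ε : Finset.Icc 1 n → Bool) :
    ∃ p ∈ bruhatIntervalPolytope (addTail u) (addTail u * sDown n), ∀ k,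
      (initVec n (apexEdge a b (k, ε k)).2 - initVec n (apexEdge a b (k, ε k)).1) ⬝ᵥ p =
        chordBound (paddedSeq u) (apexEdge a b (k, ε k)).1 (apexEdge a b (k, ε k)).2 := by
  obtain ⟨z, hz, heq⟩ := exists_mem_interval_of_set u (Subtype.val '' {k | ε k = true})
  refine ⟨permPoint z, subset_convexHull ℝ _ ⟨z, (mem_interval_iff u z).2 hz, rfl⟩, fun k => ?_⟩
  obtain ⟨hchord, hle⟩ := isChord_apexEdge h (k, ε k)
  rw [initVec_sub_dotProduct_permPoint z hchord.1.le hle, chordBound]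
  obtain ⟨htrue, hfalse⟩ := heq _ _ _ (h k).1 (h k).2
  rw [Subtype.val_injective.mem_set_image, Set.mem_ofPred_eq] at htrue hfalse
  cases hε : ε k
  · exact congrArg (fun s => ((s.sum + _ : ℕ) : ℝ)) (hfalse (by simp [hε]))
  · exact congrArg (fun s => ((s.sum + _ : ℕ) : ℝ)) (htrue hε)

theorem isCubical_interval (h : ∀ k, IsApex (paddedSeq u) (a k) k (b k) ∧ b k ≤ n + 1) :
    IsCubical (bruhatIntervalPolytope (addTail u) (addTail u * sDown n))
      (fun i => initVec n (apexEdge a b i).2 - initVec n (apexEdge a b i).1)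
      (fun i => chordBound (paddedSeq u) (apexEdge a b i).1 (apexEdge a b i).2) where
  le_dotProduct p hp i :=
    chordBound_le_dotProduct (isChord_apexEdge h i).1 (isChord_apexEdge h i).2 hp
  not_both p hp k heq := by
    have hle := chordBound_le_dotProduct (h k).1.chord (h k).2 hp
    have htrue := heq true
    have hfalse := heq false
    dsimp only [apexEdge] at htrue hfalse
    rw [← sub_add_sub_cancel _ (initVec n k) _, add_dotProduct, htrue, hfalse, add_comm] at hle
    exact hle.not_gt (h k).1.chordBound_add_lt
  exists_vertex := exists_vertex_of_choice h
  sum_eq p hp q hq := (sum_eq_of_mem_bruhatIntervalPolytope hp).trans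
    (sum_eq_of_mem_bruhatIntervalPolytope hq).symm
  exists_eq_sum x := by
    refine exists_eq_sum_of_triangular (e := fun k : Finset.Icc 1 n => varpi n k)
      (g := fun i => (diagonalLine n).mkQ
        (initVec n (apexEdge a b i).2 - initVec n (apexEdge a b i).1))
      (U := fun k => paddedSeq u k) Finset.univ (fun k _ => ?_) (fun k _ => ?_)
      (by rw [Finset.coe_univ]; exact mem_span_varpi x)
    · dsimp only [apexEdge]
      rw [map_sub, mkQ_initVec, mkQ_initVec, sub_sub_cancel]
      exact varpi_mem_span fun _ => ⟨Finset.mem_univ _, (h k).1.lt_left⟩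
    · dsimp only [apexEdge]
      rw [map_sub, mkQ_initVec, mkQ_initVec, add_sub_cancel]
      exact varpi_mem_span fun _ => ⟨Finset.mem_univ _, (h k).1.apex_lt_right⟩

theorem normalFan_interval (h : ∀ k, IsApex (paddedSeq u) (a k) k (b k) ∧ b k ≤ n + 1) :
    normalFan (bruhatIntervalPolytope (addTail u) (addTail u * sDown n)) =
      crosspolytopalFan fun i => varpi n (apexEdge a b i).2 - varpi n (apexEdge a b i).1 :=
  (isCubical_interval h).normalFan_eq

end IntervalPolytope

/-! ### Triangulations of binary trees -/

section DecreasingTree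

variable {α : Type*} [Preorder α] {V : ℕ → α}

/-- The binary tree `t`, whose vertices are numbered from `o + 1` in symmetric order, is
decreasing for `V`: in each subtree the root has the largest value of `V`. -/
def IsDecreasingTree (V : ℕ → α) : BinaryTree Unit → ℕ → Prop
  | .nil, _ => True
  | .node _ l r, o =>
    (∀ i, o < i → i < o + l.numNodes + 1 + r.numNodes + 1 → i ≠ o + l.numNodes + 1 →
      V i < V (o + l.numNodes + 1)) ∧
    IsDecreasingTree V l o ∧ IsDecreasingTree V r (o + l.numNodes + 1)

theorem IsDecreasingTree.mem_treeEdges_iff {t : BinaryTree Unit} {o : ℕ}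
    (ht : IsDecreasingTree V t o) (hV : IsChord V o (o + t.numNodes + 1)) {a b : ℕ} :
    (a, b) ∈ treeEdges t o ↔ o ≤ a ∧ b ≤ o + t.numNodes + 1 ∧ IsChord V a b := by
  induction t generalizing o with
  | nil =>
    rw [treeEdges, Finset.mem_singleton, Prod.mk.injEq, BinaryTree.numNodes]
    constructor
    · rintro ⟨rfl, rfl⟩
      exact ⟨le_rfl, le_rfl, isChord_succ V a⟩
    · rintro ⟨ha, hb, hab, -⟩
      omega
  | node _ l r ihl ihr =>
    obtain ⟨hroot, hl, hr⟩ := ht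
    have hend : o + (l.numNodes + r.numNodes + 1) + 1 =
        o + l.numNodes + 1 + r.numNodes + 1 := by omega
    rw [BinaryTree.numNodes, hend] at hV
    have hapex : IsApex V o (o + l.numNodes + 1) (o + l.numNodes + 1 + r.numNodes + 1) :=
      ⟨hV, by omega, by omega, hroot⟩
    rw [treeEdges, Finset.mem_insert, Finset.mem_union, ihl hl hapex.chord_left,
      ihr hr hapex.chord_right, BinaryTree.numNodes, hend, Prod.mk.injEq]
    constructor
    · rintro (⟨rfl, rfl⟩ | ⟨ha, hb, hab⟩ | ⟨ha, hb, hab⟩)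
      · exact ⟨le_rfl, le_rfl, hV⟩
      · exact ⟨ha, by omega, hab⟩
      · exact ⟨by omega, hb, hab⟩
    · rintro ⟨ha, hb, hab⟩
      exact (hab.eq_or_le_or_le ha hb hroot).imp_right
        (Or.imp (fun hb' => ⟨ha, hb', hab⟩) (fun ha' => ⟨ha', hb, hab⟩))

theorem isDecreasingTree_minTree {l : List ℕ} {o : ℕ} (hl : l.Nodup)
    (hV : ∀ i j (hi : i < l.length) (hj : j < l.length), l[i] < l[j] →
      V (o + 1 + j) < V (o + 1 + i)) :
    IsDecreasingTree V (minTree l) o := by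
  fun_induction minTree l generalizing o with
  | case1 => trivial
  | case2 l h ihl ihr =>
    have hc : l.idxOf (l.min h) < l.length := List.idxOf_lt_length_of_mem (List.min_mem h)
    have hcm : l[l.idxOf (l.min h)] = l.min h := List.getElem_idxOf hc
    set c := l.idxOf (l.min h)
    rw [IsDecreasingTree, numNodes_minTree, numNodes_minTree, List.length_take_of_le hc.le,
      List.length_drop]
    refine ⟨fun i hoi hi hic => ?_, ihl (hl.sublist (List.take_sublist _ _)) ?_,
      ihr (hl.sublist (List.drop_sublist _ _)) ?_⟩
    · obtain ⟨j, rfl⟩ := Nat.exists_eq_add_of_lt hoi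
      have hj : j < l.length := by omega
      have hle : l[c] ≤ l[j] := hcm ▸ List.min_le_of_mem (List.getElem_mem hj)
      have hne : l[c] ≠ l[j] := fun heq => hic (by rw [hl.getElem_inj_iff.1 heq])
      rw [add_right_comm o j, add_right_comm o c]
      exact hV c j hc hj (hle.lt_of_ne hne)
    · intro i j hi hj hij
      rw [List.getElem_take, List.getElem_take] at hij
      exact hV i j _ _ hij
    · intro i j hi hj hij
      rw [List.getElem_drop, List.getElem_drop] at hij
      convert hV _ _ _ _ hij using 2 <;> omega

end DecreasingTree

namespace Triangulation

variable {n : ℕ} {T : Triangulation n} {α : Type*} {V : ℕ → α} {a k b : ℕ}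

theorem Reached.mem_edges (h : T.Reached a b) : (a, b) ∈ T.edges := by
  cases h with
  | root => exact T.distinguished_mem
  | left _ h => exact h.2.2.1
  | right _ h => exact h.2.2.2.1

theorem isTriangle_iff_isApex [Preorder α]
    (hT : ∀ a b, (a, b) ∈ T.edges ↔ b ≤ n + 1 ∧ IsChord V a b) :
    T.IsTriangle a k b ↔ IsApex V a k b ∧ b ≤ n + 1 := by
  simp only [IsTriangle, hT]
  constructor
  · rintro ⟨hak, hkb, ⟨-, hleft⟩, ⟨-, hright⟩, hb, hchord⟩
    refine ⟨⟨hchord, hak, hkb, fun i hi hi' hik => ?_⟩, hb⟩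
    rcases hik.lt_or_gt with hik | hki
    · exact (hleft.2 i hi hik).2
    · exact (hright.2 i hki hi').1
  · rintro ⟨h, hb⟩
    exact ⟨h.left_lt, h.lt_right, ⟨h.lt_right.le.trans hb, h.chord_left⟩, ⟨hb, h.chord_right⟩, hb,
      h.chord⟩

variable [LinearOrder α]

theorem reached_of_mem_edges (hT : ∀ a b, (a, b) ∈ T.edges ↔ b ≤ n + 1 ∧ IsChord V a b)
    (hV : Set.InjOn V (Set.Ioo 0 (n + 1))) (hab : (a, b) ∈ T.edges) : T.Reached a b := by
  obtain ⟨hb, hchord⟩ := (hT a b).1 hab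
  suffices h : ∀ d x y, y - x = d → T.Reached x y → x ≤ a → b ≤ y → T.Reached a b from
    h _ _ _ rfl .root (Nat.zero_le _) hb
  intro d
  induction d using Nat.strong_induction_on with
  | _ d ih =>
    rintro x y rfl hxy hxa hby
    rcases eq_or_ne (x + 1) y with rfl | hne
    · obtain ⟨rfl, rfl⟩ : x = a ∧ b = x + 1 := by have := hchord.1; omega
      exact hxy
    obtain ⟨hy, hxy'⟩ := (hT x y).1 hxy.mem_edges
    obtain ⟨c, hxc, hcy, hc⟩ := exists_forall_lt_of_injOn (V := V)
      (lt_of_le_of_ne hxy'.1 hne) (hV.mono (Set.Ioo_subset_Ioo (Nat.zero_le _) hy))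
    have htri : T.IsTriangle x c y := (isTriangle_iff_isApex hT).2 ⟨⟨hxy', hxc, hcy, hc⟩, hy⟩
    rcases hchord.eq_or_le_or_le hxa hby hc with ⟨rfl, rfl⟩ | hbc | hca
    · exact hxy
    · exact ih (c - x) (by omega) x c rfl (hxy.left htri) hxa hbc
    · exact ih (y - c) (by omega) c y rfl (hxy.right htri) hca hby

theorem leftNbr_eq_and_rightNbr_eq (hT : ∀ a b, (a, b) ∈ T.edges ↔ b ≤ n + 1 ∧ IsChord V a b)
    (hV : Set.InjOn V (Set.Ioo 0 (n + 1))) (h : IsApex V a k b) (hb : b ≤ n + 1) :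
    T.leftNbr k = a ∧ T.rightNbr k = b := by
  have htri : T.IsTriangle a k b := (isTriangle_iff_isApex hT).2 ⟨h, hb⟩
  have hreach : T.Reached a b := reached_of_mem_edges hT hV ((hT a b).2 ⟨hb, h.chord⟩)
  have hunique : ∀ {x y}, T.IsTriangle x k y → x = a ∧ y = b := fun hxy =>
    ((isTriangle_iff_isApex hT).1 hxy).1.unique h
  have hleft : {x | T.IsLeftEdge x k} = {a} :=
    Set.eq_singleton_iff_unique_mem.2 ⟨⟨b, hreach, htri⟩, fun _ ⟨_, _, hxy⟩ => (hunique hxy).1⟩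
  have hright : {y | T.IsRightEdge k y} = {b} :=
    Set.eq_singleton_iff_unique_mem.2 ⟨⟨a, hreach, htri⟩, fun _ ⟨_, _, hxy⟩ => (hunique hxy).2⟩
  exact ⟨by rw [leftNbr, hleft, csInf_singleton], by rw [rightNbr, hright, csInf_singleton]⟩

end Triangulation

section Psi

variable {n : ℕ}

theorem exists_isApex (u : Equiv.Perm (Fin n)) {k : ℕ} (hk : k ∈ Finset.Icc 1 n) :
    ∃ a b, IsApex (paddedSeq u) a k b ∧ b ≤ n + 1 := by
  obtain ⟨hk1, hkn⟩ := Finset.mem_Icc.1 hk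
  have hlt : paddedSeq u k < n := paddedSeq_lt u hk1 (Nat.lt_succ_of_le hkn)
  exact exists_isApex_of_injOn hk1 (Nat.lt_succ_of_le hkn) ((paddedSeq_zero u).symm ▸ hlt)
    ((paddedSeq_last u).symm ▸ hlt) (injOn_paddedSeq u)

theorem longest_conj_apply (u : Equiv.Perm (Fin n)) {i : ℕ} (hi : i < n) :
    ((longest n * u * longest n) ⟨i, hi⟩ : ℕ) = n - (paddedSeq u (n - i) + 1) := by
  rw [paddedSeq, dif_pos (by omega), longest, Equiv.Perm.mul_apply, Equiv.Perm.mul_apply,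
    Fin.revPerm_apply, Fin.revPerm_apply, Fin.val_rev]
  congr 4

theorem mem_psi_edges (u : Equiv.Perm (Fin n)) (a b : ℕ) :
    (a, b) ∈ (psi (longest n * u * longest n)).edges ↔
      b ≤ n + 1 ∧ IsChord (fun j => paddedSeq u (n + 1 - j)) a b := by
  have hlength : (minTree (List.ofFn fun i => ((longest n * u * longest n) i : ℕ))).numNodes =
      n := by
    rw [numNodes_minTree, List.length_ofFn]
  have hdecr : IsDecreasingTree (fun j => paddedSeq u (n + 1 - j))
      (minTree (List.ofFn fun i => ((longest n * u * longest n) i : ℕ))) 0 := by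
    refine isDecreasingTree_minTree
      (List.nodup_ofFn.2 (Fin.val_injective.comp (Equiv.injective _))) fun i j hi hj hij => ?_
    rw [List.length_ofFn] at hi hj
    rw [List.getElem_ofFn, List.getElem_ofFn, longest_conj_apply, longest_conj_apply] at hij
    rw [show n + 1 - (0 + 1 + j) = n - j by omega, show n + 1 - (0 + 1 + i) = n - i by omega]
    omega
  have hchord : IsChord (fun j => paddedSeq u (n + 1 - j)) 0 (n + 1) := by
    refine ⟨n.succ_pos, fun i hi hi' => ?_⟩
    dsimp only
    rw [Nat.sub_zero, Nat.sub_self, paddedSeq_zero, paddedSeq_last, and_self_iff]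
    exact paddedSeq_lt u (by omega) (by omega)
  have hiff := hdecr.mem_treeEdges_iff (a := a) (b := b) (by rwa [hlength, zero_add])
  rw [hlength, zero_add] at hiff
  exact hiff.trans (and_iff_right (Nat.zero_le a))

theorem psi_leftNbr_eq_and_rightNbr_eq (u : Equiv.Perm (Fin n)) {a k b : ℕ}
    (h : IsApex (paddedSeq u) a k b) (hb : b ≤ n + 1) :
    (psi (longest n * u * longest n)).leftNbr (n + 1 - k) = n + 1 - b ∧
      (psi (longest n * u * longest n)).rightNbr (n + 1 - k) = n + 1 - a := by
  refine Triangulation.leftNbr_eq_and_rightNbr_eq (mem_psi_edges u) ?_ (h.reflect hb)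
    (Nat.sub_le _ _)
  refine (injOn_paddedSeq u).comp (fun i hi j hj hij => ?_) fun i hi => ?_
  · simp only [Set.mem_Ioo] at hi hj hij
    omega
  · simp only [Set.mem_Ioo] at hi ⊢
    omega

end Psi

/-! ### The isomorphism of fans -/

namespace Triangulation

variable {n : ℕ} (T : Triangulation n)

/-- The vectors `v_k`, with the second index `true`, and `w_k`. -/
noncomputable def rays : Finset.Icc 1 n × Bool → NReal n
  | (k, true) => T.vVec k
  | (k, false) => T.wVec k

theorem fan_eq_crosspolytopalFan : T.fan = crosspolytopalFan T.rays := by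
  ext σ
  refine exists_congr fun Q => and_congr ?_ (and_congr_left' ?_)
  · refine forall₂_congr fun y _ => ?_
    simp only [Set.mem_range, Prod.exists, Bool.exists_bool, rays, Subtype.exists, exists_prop,
      eq_comm (a := y), or_comm]
  · simp only [Subtype.forall, Bool.forall_bool, rays, and_comm]

end Triangulation

variable {n : ℕ}

/-- The automorphism `(x_1, …, x_{n+1}) ↦ -(x_{n+1}, …, x_1)` of `ℝ^{n+1}`. -/
noncomputable def negRev (n : ℕ) : (Fin (n + 1) → ℝ) ≃ₗ[ℝ] (Fin (n + 1) → ℝ) :=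
  (LinearEquiv.funCongrLeft ℝ ℝ Fin.revPerm).trans (LinearEquiv.neg ℝ)

theorem negRev_apply (x : Fin (n + 1) → ℝ) (j : Fin (n + 1)) : negRev n x j = -x j.rev := rfl

theorem map_negRev_diagonalLine (n : ℕ) :
    (diagonalLine n).map (negRev n : (Fin (n + 1) → ℝ) →ₗ[ℝ] _) = diagonalLine n := by
  have h : negRev n (fun _ => 1) = -fun _ => 1 := rfl
  rw [diagonalLine, Submodule.map_span, Set.image_singleton, LinearEquiv.coe_coe, h,
    ← Set.neg_singleton, Submodule.span_neg]

/-- The automorphism of `N ⊗ ℝ` that is induced by `negRev`. It accounts for the conjugation by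
the longest element. -/
noncomputable def negRevN (n : ℕ) : NReal n ≃ₗ[ℝ] NReal n :=
  Submodule.Quotient.equiv _ _ (negRev n) (map_negRev_diagonalLine n)

theorem negRevN_mkQ (x : Fin (n + 1) → ℝ) :
    negRevN n ((diagonalLine n).mkQ x) = (diagonalLine n).mkQ (negRev n x) := rfl

theorem negRevN_varpi {i : ℕ} (hi : i ≤ n + 1) :
    negRevN n (varpi n i) = varpi n (n + 1 - i) := by
  rw [← mkQ_initVec, ← mkQ_initVec, negRevN_mkQ, Submodule.mkQ_apply, Submodule.mkQ_apply,
    Submodule.Quotient.eq, diagonalLine, Submodule.mem_span_singleton]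
  refine ⟨-1, ?_⟩
  ext j
  have hj : (j.rev : ℕ) < i ↔ ¬ (j : ℕ) < n + 1 - i := by rw [Fin.val_rev]; omega
  rw [Pi.smul_apply, Pi.sub_apply, negRev_apply, initVec, initVec, if_congr hj rfl rfl, ite_not]
  split_ifs <;> norm_num

theorem negRevN_involutive (n : ℕ) : Function.Involutive (negRevN n) := by
  intro x
  obtain ⟨y, rfl⟩ := (diagonalLine n).mkQ_surjective x
  rw [negRevN_mkQ, negRevN_mkQ]
  congr 1
  ext j
  rw [negRev_apply, negRev_apply, neg_neg, Fin.rev_rev]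

theorem negRevN_mem_latticeN {x : NReal n} (hx : x ∈ latticeN n) : negRevN n x ∈ latticeN n := by
  obtain ⟨_, ⟨m, rfl⟩, rfl⟩ := hx
  refine ⟨_, ⟨fun j => -m j.rev, rfl⟩, congrArg (diagonalLine n).mkQ ?_⟩
  ext j
  exact Int.cast_neg _

theorem map_negRevN_latticeN (n : ℕ) :
    (latticeN n).map (negRevN n : NReal n →ₗ[ℝ] NReal n).toAddMonoidHom = latticeN n := by
  refine le_antisymm ?_ fun x hx => ⟨negRevN n x, negRevN_mem_latticeN hx, negRevN_involutive n x⟩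
  rintro _ ⟨x, hx, rfl⟩
  exact negRevN_mem_latticeN hx

/-- The reflection `k ↦ n + 1 - k` of `{1, …, n}`. -/
def reflectIcc (n : ℕ) (k : Finset.Icc 1 n) : Finset.Icc 1 n :=
  ⟨n + 1 - k, by have := Finset.mem_Icc.1 k.2; rw [Finset.mem_Icc]; omega⟩

theorem reflectIcc_involutive (n : ℕ) : Function.Involutive (reflectIcc n) := fun k =>
  Subtype.ext (Nat.sub_sub_self ((Finset.mem_Icc.1 k.2).2.trans n.le_succ))

theorem rays_psi_comp_reflectIcc {u : Equiv.Perm (Fin n)} {a b : Finset.Icc 1 n → ℕ}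
    (h : ∀ k, IsApex (paddedSeq u) (a k) k (b k) ∧ b k ≤ n + 1) :
    (psi (longest n * u * longest n)).rays ∘ Prod.map (reflectIcc n) id =
      negRevN n ∘ fun i => varpi n (apexEdge a b i).2 - varpi n (apexEdge a b i).1 := by
  funext i
  obtain ⟨hchord, hle⟩ := isChord_apexEdge h i
  rw [Function.comp_apply, Function.comp_apply, map_sub, negRevN_varpi hle,
    negRevN_varpi (hchord.1.le.trans hle)]
  obtain ⟨hleft, hright⟩ := psi_leftNbr_eq_and_rightNbr_eq u (h i.1).1 (h i.1).2
  obtain ⟨k, _ | _⟩ := i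
  · exact congrArg (fun j => varpi n j - varpi n (n + 1 - k)) hleft
  · exact congrArg (fun j => varpi n (n + 1 - k) - varpi n j) hright

end CatalanFan

open CatalanFan in
theorem theorem6p5 (n : ℕ) (u : Equiv.Perm (Fin n)) :
    CatalanFan.FanIsomorphic
      (CatalanFan.latticeN n)
      (CatalanFan.normalFan
        (CatalanFan.bruhatIntervalPolytope
          (CatalanFan.addTail u) (CatalanFan.addTail u * CatalanFan.sDown n)))
      (CatalanFan.latticeN n)
      (CatalanFan.psi (CatalanFan.longest n * u * CatalanFan.longest n)).fan := by
  choose a b hab using fun k : Finset.Icc 1 n => exists_isApex u k.2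
  refine ⟨negRevN n, map_negRevN_latticeN n, ?_⟩
  rw [normalFan_interval hab, Triangulation.fan_eq_crosspolytopalFan,
    ← crosspolytopalFan_comp_map (psi _).rays (reflectIcc_involutive n).surjective,
    rays_psi_comp_reflectIcc hab]
  exact bijOn_crosspolytopalFan (negRevN n) _
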